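/- Let $K$ be a field of characteristic zero, let $a,b>1$ be integers, and let \[ R = K[x_iy_j \mid 1\le i\le a,\ 1\le j\le b]\subseteq K[x_1,\dots,x_a,y_1,\dots,y_b] \] be the Segre ring. Let $D_{R|K}=\bigcup_n D^n_{R|K}\subseteq \operatorname{End}_K(R)$ be its ring of $K$-linear differential operators, where $D^0_{R|K}=\operatorname{Hom}_R(R,R)$ and $D^{n+1}_{R|K}$ consists of the $\delta\in\operatorname{End}_K(R)$ with $[\delta,\overline{r}]\in D^n_{R|K}$ for all $r\in R$ ($\overline{r}$ being multiplication by $r$). For $f\in R$, the polynomials $c(s)\in K[s]$ for which there exist finitely many $\alpha_i(s),\beta_i(s)\in D_{R|K}[s]$ such that \[ \sum_i \alpha_i(n)\,\overline{f}^{\,n+1}\,\beta_i(n)=c(n)\,\overline{f}^{\,n}\quad\text{in } D_{R|K}\text{ for all } n\in\mathbb{N} \] (products being compositions of operators, $\mathbb{N}=\{0,1,2,\dots\}$) form an ideal of $K[s]$. The sandwich Bernstein–Sato polynomial of $f$ is the monic generator of this ideal (and $0$ if the ideal is zero). Then the sandwich Bernstein–Sato polynomial of $x_1y_1\in R$ is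 nonzero and divides $(s+1)^3(s+a)(s+b)$, and each of $-1$, $-a$, $-b$ is a root of it. -/

import Mathlib

open Polynomial

/-- The `A`-module `D^n_{R|A}` of `A`-linear differential operators on `R` of order at most `n`:
`D^0` consists of the `R`-linear endomorphisms of `R`, and `D^{n+1}` of the `A`-linear
endomorphisms whose commutator with (multiplication by) every element of `R` lies in `D^n`. -/
def diffOpOrder (A R : Type*) [CommRing A] [CommRing R] [Algebra A R] :
    ℕ → Submodule A (Module.End A R)
  | 0 =>
    { carrier := {δ | ∀ r x : R, δ (r * x) = r * δ x}
      add_mem' := fun {δ ε} hδ hε r x => by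
        simp only [LinearMap.add_apply, hδ r x, hε r x, mul_add]
      zero_mem' := fun r x => by simp
      smul_mem' := fun c δ hδ r x => by
        simp only [LinearMap.smul_apply, hδ r x, mul_smul_comm] }
  | n + 1 =>
    { carrier := {δ | ∀ r : R,
        δ * LinearMap.mulLeft A r - LinearMap.mulLeft A r * δ ∈ diffOpOrder A R n}
      add_mem' := fun {δ ε} hδ hε r => by
        have h := (diffOpOrder A R n).add_mem (hδ r) (hε r)
        rwa [sub_add_sub_comm, ← add_mul, ← mul_add] at h
      zero_mem' := fun r => by simp
      smul_mem' := fun c δ hδ r => by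
        have h := (diffOpOrder A R n).smul_mem c (hδ r)
        rwa [smul_sub, ← smul_mul_assoc, ← mul_smul_comm] at h }

section DiffOp

variable {A R : Type*} [CommRing A] [CommRing R] [Algebra A R]

theorem mem_diffOpOrder_zero {δ : Module.End A R} :
    δ ∈ diffOpOrder A R 0 ↔ ∀ r x : R, δ (r * x) = r * δ x := Iff.rfl

theorem mem_diffOpOrder_succ {n : ℕ} {δ : Module.End A R} :
    δ ∈ diffOpOrder A R (n + 1) ↔ ∀ r : R,
      δ * LinearMap.mulLeft A r - LinearMap.mulLeft A r * δ ∈ diffOpOrder A R n := Iff.rfl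

theorem diffOpOrder_comm_of_zero {δ : Module.End A R} (h : δ ∈ diffOpOrder A R 0) (r : R) :
    δ * LinearMap.mulLeft A r - LinearMap.mulLeft A r * δ = 0 := by
  ext x
  simp [mem_diffOpOrder_zero.1 h r x]

theorem diffOpOrder_le_succ (n : ℕ) : diffOpOrder A R n ≤ diffOpOrder A R (n + 1) := by
  induction n with
  | zero =>
    intro δ h r
    rw [diffOpOrder_comm_of_zero h r]
    exact zero_mem _
  | succ n ih =>
    intro δ h r
    exact ih (h r)

theorem diffOpOrder_mono : Monotone (diffOpOrder A R) :=
  monotone_nat_of_le_succ diffOpOrder_le_succ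

theorem mulLeft_mem_diffOpOrder_zero (r : R) :
    LinearMap.mulLeft A r ∈ diffOpOrder A R 0 := by
  intro s x
  simp only [LinearMap.mulLeft_apply]
  ring

theorem mul_mem_diffOpOrder (k : ℕ) : ∀ (m n : ℕ) (_ : m + n = k) (δ ε : Module.End A R),
    δ ∈ diffOpOrder A R m → ε ∈ diffOpOrder A R n → δ * ε ∈ diffOpOrder A R k := by
  induction k with
  | zero =>
    intro m n hk δ ε hδ hε
    obtain ⟨rfl, rfl⟩ : m = 0 ∧ n = 0 := by omega
    intro r x
    rw [Module.End.mul_apply, Module.End.mul_apply, mem_diffOpOrder_zero.1 hε,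
      mem_diffOpOrder_zero.1 hδ]
  | succ k ih =>
    intro m n hk δ ε hδ hε r
    have key : δ * ε * LinearMap.mulLeft A r - LinearMap.mulLeft A r * (δ * ε)
        = δ * (ε * LinearMap.mulLeft A r - LinearMap.mulLeft A r * ε)
          + (δ * LinearMap.mulLeft A r - LinearMap.mulLeft A r * δ) * ε := by
      simp only [mul_sub, sub_mul, mul_assoc]
      abel
    rw [key]
    refine add_mem ?_ ?_
    · cases n with
      | zero => rw [diffOpOrder_comm_of_zero hε, mul_zero]; exact zero_mem _
      | succ n => exact ih m n (by omega) _ _ hδ (hε r)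
    · cases m with
      | zero => rw [diffOpOrder_comm_of_zero hδ, zero_mul]; exact zero_mem _
      | succ m => exact ih m n (by omega) _ _ (hδ r) hε

end DiffOp

/-- The ring `D_{R|A} = ⋃ₙ D^n_{R|A}` of `A`-linear differential operators on `R`, with
composition as multiplication. -/
def diffOpRing (A R : Type*) [CommRing A] [CommRing R] [Algebra A R] :
    Subalgebra A (Module.End A R) where
  carrier := {δ | ∃ n, δ ∈ diffOpOrder A R n}
  mul_mem' := fun {δ ε} ⟨m, hm⟩ ⟨n, hn⟩ => ⟨m + n, mul_mem_diffOpOrder _ m n rfl δ ε hm hn⟩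
  add_mem' := fun {_ _} ⟨m, hm⟩ ⟨n, hn⟩ => ⟨max m n,
    add_mem (diffOpOrder_mono (le_max_left m n) hm) (diffOpOrder_mono (le_max_right m n) hn)⟩
  algebraMap_mem' := fun c => ⟨0, fun r x => by
    simp only [Module.algebraMap_end_apply, mul_smul_comm]⟩

/-- The element of `D_{R|A}` given by multiplication by `r`. -/
def diffOpRing.mulBy (A : Type*) {R : Type*} [CommRing A] [CommRing R] [Algebra A R] (r : R) :
    diffOpRing A R :=
  ⟨LinearMap.mulLeft A r, 0, mulLeft_mem_diffOpOrder_zero r⟩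

/-- `b(s)` satisfies a sandwich Bernstein–Sato equation for `f`: there are finitely many
`αᵢ(s), βᵢ(s) ∈ D_{R|K}[s]` with `∑ᵢ αᵢ(n) f^{n+1} βᵢ(n) = b(n) f^n` in `D_{R|K}`
(products being compositions of operators) for all `n ∈ ℕ`. -/
def SatisfiesSBSEquation (K : Type*) {R : Type*} [Field K] [CommRing R] [Algebra K R]
    (f : R) (b : K[X]) : Prop :=
  ∃ (t : ℕ) (α β : Fin t → (diffOpRing K R)[X]), ∀ n : ℕ,
    ∑ i, (α i).eval (n : diffOpRing K R) * diffOpRing.mulBy K f ^ (n + 1)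
        * (β i).eval (n : diffOpRing K R)
      = b.eval (n : K) • diffOpRing.mulBy K f ^ n

/-- The ideal of all polynomials satisfying a sandwich Bernstein–Sato equation for `f`. -/
def sbsIdeal (K : Type*) {R : Type*} [Field K] [CommRing R] [Algebra K R] (f : R) :
    Ideal K[X] where
  carrier := {b | SatisfiesSBSEquation K f b}
  zero_mem' := ⟨0, Fin.elim0, Fin.elim0, fun n => by simp⟩
  add_mem' := by
    rintro b c ⟨t, α, β, h⟩ ⟨t', α', β', h'⟩
    refine ⟨t + t', Fin.append α α', Fin.append β β', fun n => ?_⟩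
    rw [Fin.sum_univ_add]
    simp only [Fin.append_left, Fin.append_right]
    rw [h, h', eval_add, add_smul]
  smul_mem' := by
    rintro k b ⟨t, α, β, h⟩
    refine ⟨t, fun i => k.map (algebraMap K (diffOpRing K R)) * α i, β, fun n => ?_⟩
    have key : ∀ i, (k.map (algebraMap K (diffOpRing K R)) * α i).eval (n : diffOpRing K R)
        = k.eval (n : K) • (α i).eval (n : diffOpRing K R) := by
      intro i
      rw [eval, eval₂_mul_noncomm _ _ fun _ => Nat.commute_cast _ _, ← eval, ← eval,
        eval_natCast_map, Algebra.smul_def]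
    simp only [key, smul_mul_assoc]
    rw [← Finset.smul_sum, h, smul_eq_mul, eval_mul, mul_smul]

/-- The sandwich Bernstein–Sato polynomial of `f`: the monic generator of the ideal of
polynomials satisfying a sandwich Bernstein–Sato equation for `f`, and `0` if this ideal is
zero. -/
noncomputable def sbsPolynomial (K : Type*) {R : Type*} [Field K] [CommRing R] [Algebra K R]
    (f : R) : K[X] :=
  Submodule.IsPrincipal.generator (sbsIdeal K f) *
    C (Submodule.IsPrincipal.generator (sbsIdeal K f)).leadingCoeff⁻¹

theorem monic_sbsPolynomial {K R : Type*} [Field K] [CommRing R] [Algebra K R] {f : R}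
    (h : sbsIdeal K f ≠ ⊥) : (sbsPolynomial K f).Monic :=
  monic_mul_leadingCoeff_inv fun h0 =>
    h ((Submodule.IsPrincipal.eq_bot_iff_generator_eq_zero _).2 h0)

theorem span_sbsPolynomial {K R : Type*} [Field K] [CommRing R] [Algebra K R] (f : R) :
    Ideal.span {sbsPolynomial K f} = sbsIdeal K f := by
  by_cases h0 : Submodule.IsPrincipal.generator (sbsIdeal K f) = 0
  · rw [(Submodule.IsPrincipal.eq_bot_iff_generator_eq_zero _).2 h0, sbsPolynomial, h0]
    simp
  · rw [sbsPolynomial, Ideal.span_singleton_mul_right_unit, Ideal.span_singleton_generator]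
    exact isUnit_C.2 (IsUnit.mk0 _ (inv_ne_zero (leadingCoeff_ne_zero.2 h0)))

/-- The Segre ring `K[x_i y_j | 1 ≤ i ≤ a, 1 ≤ j ≤ b]`, as a subalgebra of the polynomial ring
`K[x_1, …, x_a, y_1, …, y_b]`; indices are shifted to start at `0`. -/
noncomputable def segreRing (K : Type*) [Field K] (a b : ℕ) :
    Subalgebra K (MvPolynomial (Fin a ⊕ Fin b) K) :=
  Algebra.adjoin K (Set.range fun p : Fin a × Fin b =>
    MvPolynomial.X (Sum.inl p.1) * MvPolynomial.X (Sum.inr p.2))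

/-- The element `x_i y_j` of the Segre ring. -/
noncomputable def segreRing.xy (K : Type*) [Field K] {a b : ℕ} (i : Fin a) (j : Fin b) :
    segreRing K a b :=
  ⟨MvPolynomial.X (Sum.inl i) * MvPolynomial.X (Sum.inr j),
    Algebra.subset_adjoin ⟨(i, j), rfl⟩⟩

/-! Write f = x_i y_j. The roots come from pole orders, the divisibility from an explicit identity.

Roots. Let L be the ring of Laurent polynomials with equal total degrees in the x's and the y's. It
is a localization of R in which f is a unit, and differential operators on R extend uniquely to L
(`exists_diffOp_extension`, `diffOp_ext`). Conjugating an operator by f^n is polynomial in n, since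
each difference in n lowers the order (`isPolyFun_conj`). A sandwich equation valid for all natural
n is therefore valid on L for all integers n (`SatisfiesSBSEquation.exists_int`). For a,b > 1,
extended operators create no pole along any coordinate
(`segreRing.nonneg_of_coeff_diffOpExt_ne_zero`). For n = -1, -a, -b there is a Laurent monomial m
from which no chain βᵢ, f^(n+1), αᵢ can reach f^n m, so the coefficient c(n) must vanish
(`segreRing.eval_eq_zero_of_satisfiesSBSEquation`).

Divisibility. With g = f^(n+1), ∂x = ∂_{x_i} and ∂y = ∂_{y_j}, the Leibniz rule gives ∂x∂y g =
(n+1)^2 f^n + ∂x g ∂y + ∂y g ∂x - g ∂x∂y. The middle terms are not sandwiches over R, because a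
single partial derivative does not preserve R. However, (n+b) ∂x g ∂y and (n+a) ∂y g ∂x are
sandwiches, by Euler's formula and the equality of x- and y-degrees on R
(`sum_sub_sum_derivation_sandwich`). Multiplying by (n+a)(n+b) yields (s+1)^2(s+a)(s+b)
(`segreRing.satisfiesSBSEquation_xy`). -/

/-! ### Differential operators on a localization -/

section Extension

variable {A R L : Type*} [CommRing A] [CommRing R] [CommRing L] [Algebra A R] [Algebra A L]

/-- `ι : R → L` presents `L` as an injective localization of `R`: every element of `L` is a
fraction of elements of `R`. -/
structure IsFractions (ι : R →ₐ[A] L) : Prop where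
  injective : Function.Injective ι
  exists_denom : ∀ z : L, ∃ g h : R, IsUnit (ι g) ∧ ι g * z = ι h

/-- Induction on the order: [D, g] also kills R, so it is zero and D commutes with g. If gz lies in
R, then g D(z) = D(gz) = 0 with g a unit. -/
theorem diffOp_eq_zero_of_comp {ι : R →ₐ[A] L} (hι : IsFractions ι) (n : ℕ) :
    ∀ D : Module.End A L, D ∈ diffOpOrder A L n → (∀ r, D (ι r) = 0) → D = 0 := by
  induction n with
  | zero =>
    intro D hD h0
    ext z
    have h1 := mem_diffOpOrder_zero.1 hD z 1
    have h2 := h0 1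
    rw [map_one] at h2
    simpa [h2] using h1
  | succ n ih =>
    intro D hD h0
    ext z
    obtain ⟨g, h, hg, hz⟩ := hι.exists_denom z
    have h1 := ih _ (hD (ι g)) fun r => by
      simp [← map_mul, h0]
    have h2 := LinearMap.congr_fun h1 z
    simp only [LinearMap.sub_apply, Module.End.mul_apply, LinearMap.mulLeft_apply,
      LinearMap.zero_apply, hz, h0, zero_sub, neg_eq_zero] at h2
    exact (hg.mul_right_eq_zero).1 h2

theorem diffOp_ext {ι : R →ₐ[A] L} (hι : IsFractions ι) {D E : Module.End A L}
    (hD : D ∈ diffOpRing A L) (hE : E ∈ diffOpRing A L) (h : ∀ r, D (ι r) = E (ι r)) :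
    D = E := by
  obtain ⟨n, hn⟩ := sub_mem hD hE
  exact sub_eq_zero.1 (diffOp_eq_zero_of_comp hι n _ hn fun r => by simp [h])

theorem mul_mulLeft_mem_diffOpOrder {n : ℕ} {D : Module.End A L} (hD : D ∈ diffOpOrder A L n)
    (l : L) : D * LinearMap.mulLeft A l ∈ diffOpOrder A L n :=
  mul_mem_diffOpOrder n n 0 rfl _ _ hD (mulLeft_mem_diffOpOrder_zero l)

theorem mulLeft_mul_mem_diffOpOrder {n : ℕ} {D : Module.End A L} (hD : D ∈ diffOpOrder A L n)
    (l : L) : LinearMap.mulLeft A l * D ∈ diffOpOrder A L n :=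
  mul_mem_diffOpOrder n 0 n (zero_add n) _ _ (mulLeft_mem_diffOpOrder_zero l) hD

/-- It suffices to check the commutators with elements of `R`. -/
theorem mem_diffOpOrder_succ_of_fractions {ι : R →ₐ[A] L} (hι : IsFractions ι) {n : ℕ}
    {D : Module.End A L}
    (h : ∀ r : R, D * LinearMap.mulLeft A (ι r) - LinearMap.mulLeft A (ι r) * D
      ∈ diffOpOrder A L n) : D ∈ diffOpOrder A L (n + 1) := by
  intro l
  obtain ⟨g, r, ⟨u, hu⟩, hz⟩ := hι.exists_denom l
  rw [← hu] at hz
  have hl : l = (↑u⁻¹ : L) * ι r := by rw [← hz, Units.inv_mul_cancel_left]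
  -- From r = g l one gets [D, r] = [D, g] l + g [D, l], which is solved for [D, l].
  have key : D * LinearMap.mulLeft A l - LinearMap.mulLeft A l * D
      = LinearMap.mulLeft A (↑u⁻¹ : L) *
          ((D * LinearMap.mulLeft A (ι r) - LinearMap.mulLeft A (ι r) * D)
          - (D * LinearMap.mulLeft A (ι g) - LinearMap.mulLeft A (ι g) * D)
            * LinearMap.mulLeft A l) := by
    ext x
    simp only [LinearMap.sub_apply, Module.End.mul_apply, LinearMap.mulLeft_apply, ← hu, mul_sub,
      Units.inv_mul_cancel_left]
    rw [← mul_assoc (u : L) l x, hz, hl]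
    ring
  rw [key]
  exact mulLeft_mul_mem_diffOpOrder (sub_mem (h r) (mul_mulLeft_mem_diffOpOrder (h g) l)) _

/-- If gz = h, an extension D must satisfy D(h) - g D(z) = [D, g](z). The commutator has lower
order, so its extension E_g is known by induction, which forces D(z) = g⁻¹(δ(h) - E_g(z)). The work
lies in independence of the fraction. -/
theorem exists_diffOp_extension {ι : R →ₐ[A] L} (hι : IsFractions ι) (n : ℕ) :
    ∀ δ : Module.End A R, δ ∈ diffOpOrder A R n →
      ∃ D ∈ diffOpOrder A L n, ∀ r, D (ι r) = ι (δ r) := by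
  induction n with
  | zero =>
    intro δ hδ
    refine ⟨LinearMap.mulLeft A (ι (δ 1)), mulLeft_mem_diffOpOrder_zero _, fun r => ?_⟩
    have := mem_diffOpOrder_zero.1 hδ r 1
    rw [mul_one] at this
    rw [this, LinearMap.mulLeft_apply, map_mul, mul_comm]
  | succ n ih =>
    intro δ hδ
    choose E hEmem hE using fun r => ih _ (hδ r)
    simp only [LinearMap.sub_apply, Module.End.mul_apply, LinearMap.mulLeft_apply] at hE
    have hEring : ∀ r, E r ∈ diffOpRing A L := fun r => ⟨n, hEmem r⟩
    have hmul : ∀ r, LinearMap.mulLeft A r ∈ diffOpRing A L := fun r =>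
      ⟨0, mulLeft_mem_diffOpOrder_zero r⟩
    -- The rule [δ, rs] = r[δ, s] + [δ, r]s passes to the extensions because both sides agree on R.
    have E_mul : ∀ r s z, E (r * s) z = ι r * E s z + E r (ι s * z) := by
      intro r s z
      have : E (r * s) = LinearMap.mulLeft A (ι r) * E s + E r * LinearMap.mulLeft A (ι s) :=
        diffOp_ext hι (hEring _) (add_mem (mul_mem (hmul _) (hEring _))
          (mul_mem (hEring _) (hmul _))) fun t => by
            simp only [LinearMap.add_apply, Module.End.mul_apply, LinearMap.mulLeft_apply,
              ← map_mul, hE, ← map_add]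
            congr 1
            ring_nf
      simpa using LinearMap.congr_fun this z
    have E_symm : ∀ r s z, E r (ι s * z) - ι s * E r z = E s (ι r * z) - ι r * E s z := by
      intro r s z
      have h1 := E_mul r s z
      have h2 := E_mul s r z
      rw [mul_comm s r] at h2
      linear_combination h2 - h1
    have wd : ∀ z g h g' h', ι g * z = ι h → ι g' * z = ι h' →
        ι g' * (ι (δ h) - E g z) = ι g * (ι (δ h') - E g' z) := by
      intro z g h g' h' hz hz'
      have e1 : g' * h = g * h' := hι.injective (by
        rw [map_mul, map_mul, ← hz, ← hz']; ring)
      have h1 := hE g' h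
      have h2 := hE g h'
      rw [← hz, e1] at h1
      rw [← hz'] at h2
      simp only [map_sub, map_mul] at h1 h2
      have h3 := E_symm g g' z
      linear_combination h1 - h2 + h3
    choose g h hg hgh using hι.exists_denom
    let D₀ : L → L := fun z => (↑(hg z).unit⁻¹ : L) * (ι (δ (h z)) - E (g z) z)
    have spec : ∀ z g' h', ι g' * z = ι h' → ι g' * D₀ z = ι (δ h') - E g' z := by
      intro z g' h' hz
      have h1 := wd z _ _ g' h' (hgh z) hz
      have h2 : ι (g z) * D₀ z = ι (δ (h z)) - E (g z) z := by
        rw [← mul_assoc, (hg z).mul_val_inv, one_mul]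
      refine (hg z).mul_left_cancel ?_
      linear_combination ι g' * h2 + h1
    have cancel : ∀ z z' x y, ι (g z) * (ι (g z') * x) = ι (g z) * (ι (g z') * y) → x = y :=
      fun z z' x y hxy => (hg z').mul_left_cancel ((hg z).mul_left_cancel hxy)
    let D : Module.End A L :=
      { toFun := D₀
        map_add' := fun z z' => by
          refine cancel z z' _ _ ?_
          have h1 := spec z (g z * g z') (g z' * h z) (by
            rw [map_mul, map_mul, ← hgh z]; ring)
          have h2 := spec z' (g z * g z') (g z * h z') (by
            rw [map_mul, map_mul, ← hgh z']; ring)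
          have h3 := spec (z + z') (g z * g z') (g z' * h z + g z * h z') (by
            rw [map_mul, map_add, map_mul, map_mul, ← hgh z, ← hgh z']; ring)
          simp only [map_add, map_mul] at h1 h2 h3
          linear_combination h3 - h1 - h2
        map_smul' := fun c z => by
          refine (hg z).mul_left_cancel ?_
          have h1 := spec z (g z) (h z) (hgh z)
          have h2 := spec (c • z) (g z) (c • h z) (by rw [mul_smul_comm, hgh, map_smul])
          simp only [map_smul, ← smul_sub, ← h1] at h2
          simpa [mul_smul_comm] using h2 }
    have Dspec : ∀ z g' h', ι g' * z = ι h' → ι g' * D z = ι (δ h') - E g' z := spec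
    have hext : ∀ r, D (ι r) = ι (δ r) := by
      intro r
      have h1 := Dspec (ι r) 1 r (by simp)
      rw [hE] at h1
      simpa using h1
    refine ⟨D, mem_diffOpOrder_succ_of_fractions hι fun r => ?_, hext⟩
    convert hEmem r using 1
    ext z
    simp only [LinearMap.sub_apply, Module.End.mul_apply, LinearMap.mulLeft_apply]
    refine (hg z).mul_left_cancel ?_
    have h1 := Dspec z (g z) (h z) (hgh z)
    have h2 := Dspec (ι r * z) (g z) (r * h z) (by rw [map_mul, ← hgh]; ring)
    have h3 := hE r (h z)
    have h4 := E_symm r (g z) z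
    rw [← hgh] at h3
    simp only [map_sub, map_mul] at h3
    linear_combination h2 - ι r * h1 - h3 + h4

theorem exists_diffOpRing_extension {ι : R →ₐ[A] L} (hι : IsFractions ι) (δ : diffOpRing A R) :
    ∃ D : diffOpRing A L, ∀ r, D.1 (ι r) = ι (δ.1 r) := by
  obtain ⟨n, hn⟩ := δ.2
  obtain ⟨D, hD, h⟩ := exists_diffOp_extension hι n δ.1 hn
  exact ⟨⟨D, n, hD⟩, h⟩

/-- Extension of differential operators from `R` to a localization `L`. -/
noncomputable def diffOpExt {ι : R →ₐ[A] L} (hι : IsFractions ι) :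
    diffOpRing A R →ₐ[A] diffOpRing A L :=
  have U : ∀ D E : diffOpRing A L, (∀ r, D.1 (ι r) = E.1 (ι r)) → D = E := fun D E h =>
    Subtype.ext (diffOp_ext hι D.2 E.2 h)
  have S := fun δ => (exists_diffOpRing_extension hι δ).choose_spec
  AlgHom.ofLinearMap
    { toFun := fun δ => (exists_diffOpRing_extension hι δ).choose
      map_add' := fun δ ε => U _ _ fun r => by
        rw [S]
        simp [S]
      map_smul' := fun c δ => U _ _ fun r => by
        rw [S]
        simp [S] }
    (U _ _ fun r => (S 1 r).trans (by simp))
    (fun δ ε => U _ _ fun r => (S (δ * ε) r).trans (by simp [S]))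

theorem diffOpExt_apply {ι : R →ₐ[A] L} (hι : IsFractions ι) (δ : diffOpRing A R) (r : R) :
    (diffOpExt hι δ).1 (ι r) = ι (δ.1 r) :=
  (exists_diffOpRing_extension hι δ).choose_spec r

theorem diffOpExt_mulBy {ι : R →ₐ[A] L} (hι : IsFractions ι) (f : R) :
    diffOpExt hι (diffOpRing.mulBy A f) = diffOpRing.mulBy A (ι f) :=
  Subtype.ext (diffOp_ext hι (diffOpExt hι _).2 (diffOpRing.mulBy A (ι f)).2 fun r => by
    rw [diffOpExt_apply]
    simp [diffOpRing.mulBy])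

/-- If `z = r / g` then the extension of a differential operator maps `z` into any additive
subgroup that contains the image of `R` and is closed under division by `g`. -/
theorem diffOp_apply_mem {ι : R →ₐ[A] L} (V : AddSubgroup L) (hV : ∀ r, ι r ∈ V)
    {g r : R} {z : L} (hz : ι g * z = ι r) (hgV : ∀ x, ι g * x ∈ V → x ∈ V) (n : ℕ) :
    ∀ (δ : Module.End A R) (D : Module.End A L), D ∈ diffOpOrder A L n →
      (∀ r, D (ι r) = ι (δ r)) → D z ∈ V := by
  -- D(gz) = δ(r) already lies in V, so if [D, g](z) does too, then so does g D(z), and division by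
  -- g applies.
  have step : ∀ (δ : Module.End A R) (D : Module.End A L), (∀ r, D (ι r) = ι (δ r)) →
      (D * LinearMap.mulLeft A (ι g) - LinearMap.mulLeft A (ι g) * D) z ∈ V → D z ∈ V := by
    intro δ D h hm
    apply hgV
    simp only [LinearMap.sub_apply, Module.End.mul_apply, LinearMap.mulLeft_apply, hz, h] at hm
    simpa using sub_mem (hV (δ r)) hm
  induction n with
  | zero =>
    intro δ D hD h
    refine step δ D h ?_
    rw [diffOpOrder_comm_of_zero hD]
    exact V.zero_mem
  | succ n ih =>
    intro δ D hD h
    refine step δ D h (ih (δ * LinearMap.mulLeft A g - LinearMap.mulLeft A g * δ) _ (hD (ι g)) ?_)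
    intro r
    simp [h, ← map_mul]

end Extension

/-! ### Extending the sandwich equation from natural numbers to integers -/

section Extrapolation

/-- Functions `ℤ → B` whose `N`-th iterated difference vanishes. -/
def IsDiffNilpotent {B : Type*} [Ring B] : ℕ → (ℤ → B) → Prop
  | 0, G => ∀ n, G n = 0
  | N + 1, G => IsDiffNilpotent N fun n => G (n + 1) - G n

namespace IsDiffNilpotent

variable {B : Type*} [Ring B]

theorem zero (N : ℕ) : IsDiffNilpotent N fun _ : ℤ => (0 : B) := by
  induction N with
  | zero => exact fun _ => rfl
  | succ N ih => simpa [IsDiffNilpotent] using ih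

theorem const (b : B) : IsDiffNilpotent 1 fun _ : ℤ => b := by
  simp [IsDiffNilpotent]

theorem succ {N : ℕ} : ∀ {G : ℤ → B}, IsDiffNilpotent N G → IsDiffNilpotent (N + 1) G := by
  induction N with
  | zero => intro G h n; simp [h _]
  | succ N ih => intro G h; exact ih h

theorem mono {M N : ℕ} (hMN : M ≤ N) {G : ℤ → B} (h : IsDiffNilpotent M G) :
    IsDiffNilpotent N G := by
  induction hMN with
  | refl => exact h
  | step _ ih => exact ih.succ

theorem add {N : ℕ} : ∀ {G H : ℤ → B}, IsDiffNilpotent N G → IsDiffNilpotent N H →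
    IsDiffNilpotent N fun n => G n + H n := by
  induction N with
  | zero => intro G H hG hH n; simp [hG n, hH n]
  | succ N ih =>
    intro G H hG hH
    have := ih hG hH
    simpa only [IsDiffNilpotent, sub_add_sub_comm] using this

theorem shift {N : ℕ} : ∀ {G : ℤ → B}, IsDiffNilpotent N G →
    IsDiffNilpotent N fun n => G (n + 1) := by
  induction N with
  | zero => intro G h n; exact h _
  | succ N ih => intro G h; exact ih h

theorem mul : ∀ {k M N : ℕ} (_ : M + N = k) {G H : ℤ → B}, IsDiffNilpotent M G →
    IsDiffNilpotent N H → IsDiffNilpotent k fun n => G n * H n := by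
  intro k
  induction k with
  | zero =>
    intro M N hk G H hG hH n
    obtain ⟨rfl, rfl⟩ : M = 0 ∧ N = 0 := by omega
    simp [hG n]
  | succ k ih =>
    intro M N hk G H hG hH
    have key : (fun n => G (n + 1) * H (n + 1) - G n * H n)
        = fun n => G (n + 1) * (H (n + 1) - H n) + (G (n + 1) - G n) * H n := by
      funext n; noncomm_ring
    rw [IsDiffNilpotent, key]
    refine add ?_ ?_
    · cases N with
      | zero =>
        have h0 : ∀ n, H n = 0 := hH
        simpa [h0] using zero k
      | succ N => exact ih (by omega) hG.shift hH
    · cases M with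
      | zero =>
        have h0 : ∀ n, G n = 0 := hG
        simpa [h0] using zero k
      | succ M => exact ih (by omega) hG hH

/-- The difference vanishes on ℕ, hence on ℤ by induction; the function is then constant and equal
to its value at 0. -/
theorem eq_zero {N : ℕ} : ∀ {G : ℤ → B}, IsDiffNilpotent N G → (∀ n : ℕ, G n = 0) →
    ∀ n, G n = 0 := by
  induction N with
  | zero => intro G h _; exact h
  | succ N ih =>
    intro G h h0 n
    have h1 := ih h fun m => by
      have := h0 (m + 1)
      push_cast at this
      simp [this, h0]
    have h2 : ∀ m, G (m + 1) = G m := fun m => sub_eq_zero.1 (h1 m)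
    induction n with
    | zero => exact_mod_cast h0 0
    | succ m ihm => rw [h2, ihm]
    | pred m ihm => rw [← ihm, ← h2 (-(m : ℤ) - 1), sub_add_cancel]

end IsDiffNilpotent

/-- Functions `ℤ → B` that are polynomial in the sense that some iterated difference vanishes. -/
def IsPolyFun {B : Type*} [Ring B] (G : ℤ → B) : Prop := ∃ N, IsDiffNilpotent N G

namespace IsPolyFun

variable {B : Type*} [Ring B] {G H : ℤ → B}

theorem const (b : B) : IsPolyFun fun _ : ℤ => b := ⟨1, .const b⟩

theorem add (hG : IsPolyFun G) (hH : IsPolyFun H) : IsPolyFun fun n => G n + H n := by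
  obtain ⟨M, hG⟩ := hG
  obtain ⟨N, hH⟩ := hH
  exact ⟨max M N, (hG.mono (le_max_left _ _)).add (hH.mono (le_max_right _ _))⟩

theorem mul (hG : IsPolyFun G) (hH : IsPolyFun H) : IsPolyFun fun n => G n * H n := by
  obtain ⟨M, hG⟩ := hG
  obtain ⟨N, hH⟩ := hH
  exact ⟨M + N, .mul rfl hG hH⟩

theorem of_diff (h : IsPolyFun fun n => G (n + 1) - G n) : IsPolyFun G := by
  obtain ⟨N, h⟩ := h
  exact ⟨N + 1, h⟩

theorem sub (hG : IsPolyFun G) (hH : IsPolyFun H) : IsPolyFun fun n => G n - H n := by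
  simpa [sub_eq_add_neg] using hG.add ((const (-1)).mul hH)

theorem sum {ι : Type*} (s : Finset ι) {G : ι → ℤ → B} (h : ∀ i ∈ s, IsPolyFun (G i)) :
    IsPolyFun fun n => ∑ i ∈ s, G i n := by
  classical
  induction s using Finset.induction_on with
  | empty => simpa using const (0 : B)
  | insert i s hi ih =>
    simp only [Finset.sum_insert hi]
    exact (h i (by simp)).add (ih fun j hj => h j (by simp [hj]))

theorem intCast : IsPolyFun fun n : ℤ => (n : B) :=
  ⟨2, fun n => by simp⟩

theorem pow (hG : IsPolyFun G) (k : ℕ) : IsPolyFun fun n => G n ^ k := by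
  induction k with
  | zero => simpa using const (1 : B)
  | succ k ih => simpa only [pow_succ] using ih.mul hG

theorem eval (p : B[X]) : IsPolyFun fun n : ℤ => p.eval (n : B) := by
  induction p using Polynomial.induction_on' with
  | add p q hp hq => simpa only [eval_add] using hp.add hq
  | monomial k b => simpa only [eval_monomial] using (const b).mul (intCast.pow k)

end IsPolyFun

variable {K L : Type*} [Field K] [CommRing L] [Algebra K L]

/-- Multiplication by a unit, as a unit of the ring of differential operators. -/
def diffOpRing.unitMulBy (K : Type*) {L : Type*} [Field K] [CommRing L] [Algebra K L] (u : Lˣ) :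
    (diffOpRing K L)ˣ where
  val := diffOpRing.mulBy K (u : L)
  inv := diffOpRing.mulBy K (↑u⁻¹ : L)
  val_inv := Subtype.ext (by ext; simp [diffOpRing.mulBy])
  inv_val := Subtype.ext (by ext; simp [diffOpRing.mulBy])

theorem diffOpRing.coe_unitMulBy (u : Lˣ) :
    (diffOpRing.unitMulBy K u : diffOpRing K L) = diffOpRing.mulBy K (u : L) := rfl

theorem diffOpRing.unitMulBy_zpow_apply (u : Lˣ) (n : ℤ) (z : L) :
    ((diffOpRing.unitMulBy K u ^ n : (diffOpRing K L)ˣ) : diffOpRing K L).1 z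
      = ((u ^ n : Lˣ) : L) * z := by
  let φ : Lˣ →* (diffOpRing K L)ˣ :=
    { toFun := diffOpRing.unitMulBy K
      map_one' := Units.ext (Subtype.ext (by ext; simp [unitMulBy, diffOpRing.mulBy]))
      map_mul' := fun u v => Units.ext (Subtype.ext (by
        ext; simp [unitMulBy, diffOpRing.mulBy])) }
  have : diffOpRing.unitMulBy K u ^ n = diffOpRing.unitMulBy K (u ^ n) := (map_zpow φ u n).symm
  rw [this]
  rfl

/-- The difference in n of a conjugate of D is, up to F⁻¹, a conjugate of [D, F]; this is what
lowers the order in `isPolyFun_conj`. -/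
theorem sub_conj_units_zpow {B : Type*} [Ring B] (F : Bˣ) (D : B) :
    (fun n : ℤ => ((F ^ (-(n + 1)) : Bˣ) : B) * D * ((F ^ (n + 1) : Bˣ) : B)
      - ((F ^ (-n) : Bˣ) : B) * D * ((F ^ n : Bˣ) : B))
    = fun n : ℤ => ((F⁻¹ : Bˣ) : B) *
        (((F ^ (-n) : Bˣ) : B) * (D * F - F * D) * ((F ^ n : Bˣ) : B)) := by
  funext n
  have e1 : F ^ (n + 1) = F * F ^ n := by rw [add_comm, zpow_add, zpow_one]
  have e2 : F ^ (-(n + 1)) = F⁻¹ * F ^ (-n) := by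
    rw [neg_add, zpow_add, zpow_neg_one, ← zpow_neg_one, ← zpow_add, ← zpow_add, add_comm]
  have e3 : ((F⁻¹ : Bˣ) : B) * ((F ^ (-n) : Bˣ) : B) * F = ((F ^ (-n) : Bˣ) : B) := by
    rw [← Units.val_mul, ← Units.val_mul, ← e2, ← zpow_add_one]
    congr 2
    ring
  rw [e1, e2]
  push_cast
  nth_rewrite 2 [← e3]
  simp only [mul_sub, sub_mul, mul_assoc]

theorem sum_conj_units_zpow_eq_iff {K B : Type*} [Field K] [Ring B] [Algebra K B] (F : Bˣ)
    {t : ℕ} (α β : Fin t → B) (k : K) (n : ℤ) :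
    ∑ i, (((F ^ (-n) : Bˣ) : B) * α i * ((F ^ n : Bˣ) : B)) * F * β i - algebraMap K B k = 0
      ↔ ∑ i, α i * ((F ^ (n + 1) : Bˣ) : B) * β i = k • ((F ^ n : Bˣ) : B) := by
  have e1 : ∑ i, (((F ^ (-n) : Bˣ) : B) * α i * ((F ^ n : Bˣ) : B)) * F * β i
      = ((F ^ (-n) : Bˣ) : B) * ∑ i, α i * ((F ^ (n + 1) : Bˣ) : B) * β i := by
    rw [Finset.mul_sum]
    refine Finset.sum_congr rfl fun i _ => ?_
    rw [zpow_add_one]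
    push_cast
    simp only [mul_assoc]
  have e2 : algebraMap K B k = ((F ^ (-n) : Bˣ) : B) * (k • ((F ^ n : Bˣ) : B)) := by
    rw [mul_smul_comm, ← Units.val_mul, ← zpow_add, neg_add_cancel, zpow_zero, Units.val_one,
      Algebra.smul_def, mul_one]
  rw [e1, e2, sub_eq_zero, Units.mul_right_inj]

theorem IsPolyFun.conj_monomial {B : Type*} [Ring B] {F : Bˣ} {D : B}
    (h : IsPolyFun fun n : ℤ => ((F ^ (-n) : Bˣ) : B) * D * ((F ^ n : Bˣ) : B)) (k : ℕ) :
    IsPolyFun fun n : ℤ => ((F ^ (-n) : Bˣ) : B) * (monomial k D).eval (n : B)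
      * ((F ^ n : Bˣ) : B) := by
  convert h.mul (IsPolyFun.intCast.pow k) using 2 with n
  rw [eval_monomial, mul_assoc, mul_assoc, mul_assoc, mul_assoc,
    ((Int.cast_commute n (((F ^ n : Bˣ) : B))).pow_left k).eq]

/-- A sandwich Bernstein–Sato equation extends to all integers after mapping to a ring in which
`f` becomes a unit with polynomial conjugation action. -/
theorem sandwich_equation_int {K B₀ B : Type*} [Field K] [Ring B₀] [Ring B] [Algebra K B₀]
    [Algebra K B] (φ : B₀ →ₐ[K] B) {f : B₀} {F : Bˣ} (hF : φ f = F)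
    (hconj : ∀ D : B, IsPolyFun fun n : ℤ => ((F ^ (-n) : Bˣ) : B) * D * ((F ^ n : Bˣ) : B))
    {t : ℕ} {α β : Fin t → B₀[X]} {c : K[X]}
    (h : ∀ n : ℕ, ∑ i, (α i).eval (n : B₀) * f ^ (n + 1) * (β i).eval (n : B₀)
      = c.eval (n : K) • f ^ n) (n : ℤ) :
    ∑ i, φ ((α i).eval (n : B₀)) * ((F ^ (n + 1) : Bˣ) : B) * φ ((β i).eval (n : B₀))
      = c.eval (n : K) • ((F ^ n : Bˣ) : B) := by
  have hev : ∀ (p : B₀[X]) (n : ℤ), φ (p.eval (n : B₀)) = (p.map φ.toRingHom).eval (n : B) :=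
    fun p n => (eval_intCast_map φ.toRingHom p n).symm
  have hevc : ∀ n : ℤ, algebraMap K B (c.eval (n : K))
      = (c.map (algebraMap K B)).eval (n : B) := fun n =>
    (eval_intCast_map (algebraMap K B) c n).symm
  have hconj' : ∀ p : B[X], IsPolyFun fun n : ℤ =>
      ((F ^ (-n) : Bˣ) : B) * p.eval (n : B) * ((F ^ n : Bˣ) : B) := fun p => by
    induction p using Polynomial.induction_on' with
    | add p q hp hq => simpa only [eval_add, mul_add, add_mul] using hp.add hq
    | monomial k D => exact (hconj D).conj_monomial k
  -- The equation multiplied on the left by F^(-n): only the conjugates of the αᵢ still involve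
  -- powers of F depending on n, so the expression is polynomial in n.
  have hfun : IsPolyFun fun n : ℤ => ∑ i,
      (((F ^ (-n) : Bˣ) : B) * φ ((α i).eval (n : B₀)) * ((F ^ n : Bˣ) : B)) * (F : B)
        * φ ((β i).eval (n : B₀)) - algebraMap K B (c.eval (n : K)) := by
    simp only [hev, hevc]
    exact (IsPolyFun.sum _ fun i _ => ((hconj' _).mul (.const _)).mul (.eval _)).sub (.eval _)
  obtain ⟨N, hN⟩ := hfun
  refine (sum_conj_units_zpow_eq_iff F _ _ _ _).1 (hN.eq_zero (fun m => ?_) n)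
  refine (sum_conj_units_zpow_eq_iff F _ _ _ _).2 ?_
  have h1 := congrArg φ (h m)
  simp only [map_sum, map_mul, map_pow, hF, map_smul] at h1
  exact_mod_cast h1

theorem isPolyFun_conj (u : Lˣ) (D : diffOpRing K L) :
    IsPolyFun fun n : ℤ => ((diffOpRing.unitMulBy K u ^ (-n) : (diffOpRing K L)ˣ) : diffOpRing K L)
      * D * ((diffOpRing.unitMulBy K u ^ n : (diffOpRing K L)ˣ) : diffOpRing K L) := by
  set F := diffOpRing.unitMulBy K u with hF
  have step := fun D => sub_conj_units_zpow (B := diffOpRing K L) F D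
  have main : ∀ (N : ℕ) (D : diffOpRing K L), D.1 ∈ diffOpOrder K L N →
      IsPolyFun fun n : ℤ => ((F ^ (-n) : (diffOpRing K L)ˣ) : diffOpRing K L)
      * D * ((F ^ n : (diffOpRing K L)ˣ) : diffOpRing K L) := by
    intro N
    induction N with
    | zero =>
      intro D hD
      have h0 : D * F - F * D = 0 := Subtype.ext (diffOpOrder_comm_of_zero hD (u : L))
      refine .of_diff ?_
      rw [step, h0]
      simpa using IsPolyFun.const (0 : diffOpRing K L)
    | succ N ih =>
      intro D hD
      refine .of_diff ?_
      rw [step]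
      exact (IsPolyFun.const _).mul (ih (D * F - F * D) (hD (u : L)))
  obtain ⟨N, hN⟩ := D.2
  exact main N D hN

/-- A sandwich Bernstein–Sato equation, transported to a localization in which `f` is a unit,
extends to all integers. -/
theorem SatisfiesSBSEquation.exists_int {R : Type*} [CommRing R] [Algebra K R] {ι : R →ₐ[K] L}
    (hι : IsFractions ι) {f : R} {u : Lˣ} (hu : (u : L) = ι f) {c : K[X]}
    (h : SatisfiesSBSEquation K f c) (n : ℤ) :
    ∃ (t : ℕ) (α β : Fin t → diffOpRing K R), ∀ z : L,
      ∑ i, (diffOpExt hι (α i)).1 ((u ^ (n + 1) : Lˣ) * (diffOpExt hι (β i)).1 z)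
        = c.eval (n : K) • ((u ^ n : Lˣ) * z) := by
  obtain ⟨t, α, β, h⟩ := h
  have hF : diffOpExt hι (diffOpRing.mulBy K f) = diffOpRing.unitMulBy K u := by
    rw [diffOpExt_mulBy, diffOpRing.coe_unitMulBy, hu]
  have h2 := sandwich_equation_int (B₀ := diffOpRing K R) (B := diffOpRing K L) (diffOpExt hι) hF
    (isPolyFun_conj u) h n
  refine ⟨t, fun i => (α i).eval (n : diffOpRing K R), fun i => (β i).eval (n : diffOpRing K R),
    fun z => ?_⟩
  have h3 := LinearMap.congr_fun (congrArg Subtype.val h2) z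
  simpa [diffOpRing.unitMulBy_zpow_apply] using h3

end Extrapolation

/-! ### The Segre ring as a monoid algebra, and its Laurent polynomials -/

section Segre

variable (K : Type*) [Field K] (a b : ℕ)

/-- The lattice of exponents of Laurent monomials with equal degrees in the two sets of
variables. -/
def segreLattice : AddSubgroup (Fin a ⊕ Fin b → ℤ) where
  carrier := {w | ∑ i, w (Sum.inl i) = ∑ j, w (Sum.inr j)}
  zero_mem' := by simp
  add_mem' := fun {v w} hv hw => by
    simp only [Set.mem_ofPred_eq] at hv hw
    simp [Finset.sum_add_distrib, hv, hw]
  neg_mem' := fun {v} hv => by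
    simp only [Set.mem_ofPred_eq] at hv
    simp [hv]

/-- The monoid of exponents of monomials with equal degrees in the two sets of variables. -/
def segreCone : AddSubmonoid (Fin a ⊕ Fin b →₀ ℕ) where
  carrier := {s | ∑ i, s (Sum.inl i) = ∑ j, s (Sum.inr j)}
  zero_mem' := by simp
  add_mem' := fun {v w} hv hw => by
    simp only [Set.mem_ofPred_eq] at hv hw
    simp [Finset.sum_add_distrib, hv, hw]

variable {a b}

theorem mem_segreLattice {w : Fin a ⊕ Fin b → ℤ} :
    w ∈ segreLattice a b ↔ ∑ i, w (Sum.inl i) = ∑ j, w (Sum.inr j) := Iff.rfl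

theorem mem_segreCone {s : Fin a ⊕ Fin b →₀ ℕ} :
    s ∈ segreCone a b ↔ ∑ i, s (Sum.inl i) = ∑ j, s (Sum.inr j) := Iff.rfl

theorem single_add_single_mem_segreCone (i : Fin a) (j : Fin b) :
    Finsupp.single (Sum.inl i) 1 + Finsupp.single (Sum.inr j) 1 ∈ segreCone a b := by
  simp [mem_segreCone, Finsupp.single_apply]

/-- Induction on the common degree: a monomial of positive degree is divisible by some x_i and, the
degrees being equal, by some y_j. -/
theorem monomial_mem_segreRing (n : ℕ) : ∀ s ∈ segreCone a b, ∑ i, s (Sum.inl i) = n →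
    ∀ c : K, MvPolynomial.monomial s c ∈ segreRing K a b := by
  induction n with
  | zero =>
    intro s hs hn c
    have hs' := hs
    rw [mem_segreCone, hn] at hs'
    have h0 : s = 0 := by
      ext l
      rcases l with i | j
      · exact Finset.sum_eq_zero_iff.1 hn i (Finset.mem_univ _)
      · exact Finset.sum_eq_zero_iff.1 hs'.symm j (Finset.mem_univ _)
    subst h0
    exact (segreRing K a b).algebraMap_mem c
  | succ n ih =>
    intro s hs hn c
    have hs' := hs
    rw [mem_segreCone, hn] at hs'
    obtain ⟨i, hi⟩ : ∃ i, s (Sum.inl i) ≠ 0 := by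
      by_contra! h
      simp [h] at hn
    obtain ⟨j, hj⟩ : ∃ j, s (Sum.inr j) ≠ 0 := by
      by_contra! h
      simp [h] at hs'
    have hle : Finsupp.single (Sum.inl i) 1 + Finsupp.single (Sum.inr j) 1 ≤ s := by
      intro l
      rcases l with k | k
      · by_cases hk : i = k
        · subst hk; simp; omega
        · simp [hk]
      · by_cases hk : j = k
        · subst hk; simp; omega
        · simp [hk]
    obtain ⟨t, rfl⟩ := exists_add_of_le hle
    have hxi : ∑ k, (Finsupp.single (Sum.inl i : Fin a ⊕ Fin b) 1) (Sum.inl k) = 1 := by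
      simp [Finsupp.single_apply]
    have hxj : ∑ k, (Finsupp.single (Sum.inr j : Fin a ⊕ Fin b) 1) (Sum.inr k) = 1 := by
      simp [Finsupp.single_apply]
    simp only [Finsupp.add_apply, Finset.sum_add_distrib, hxi, hxj] at hn hs'
    simp at hn hs'
    have e : MvPolynomial.monomial
        (Finsupp.single (Sum.inl i) 1 + Finsupp.single (Sum.inr j) 1 + t) c
        = (MvPolynomial.X (Sum.inl i) * MvPolynomial.X (Sum.inr j)) *
          MvPolynomial.monomial t c := by
      simp [MvPolynomial.X, MvPolynomial.monomial_mul]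
    rw [e]
    refine mul_mem (Algebra.subset_adjoin ⟨(i, j), rfl⟩) (ih t ?_ (by omega) c)
    rw [mem_segreCone]
    omega

/-- The inclusion of the monoid algebra of the Segre cone into the polynomial ring. -/
noncomputable def segreCone.toMvPolynomial :
    AddMonoidAlgebra K (segreCone a b) →ₐ[K] MvPolynomial (Fin a ⊕ Fin b) K :=
  AddMonoidAlgebra.mapDomainAlgHom K K (segreCone a b).subtype

theorem segreCone.toMvPolynomial_single (s : segreCone a b) (c : K) :
    segreCone.toMvPolynomial K (AddMonoidAlgebra.single s c) = MvPolynomial.monomial s.1 c :=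
  AddMonoidAlgebra.mapDomain_single

theorem segreCone.toMvPolynomial_injective :
    Function.Injective (segreCone.toMvPolynomial K (a := a) (b := b)) :=
  AddMonoidAlgebra.mapDomain_injective Subtype.val_injective

theorem segreCone.range_toMvPolynomial :
    (segreCone.toMvPolynomial K (a := a) (b := b)).range = segreRing K a b := by
  apply le_antisymm
  · rintro _ ⟨p, rfl⟩
    change segreCone.toMvPolynomial K p ∈ _
    induction p using AddMonoidAlgebra.induction_linear with
    | zero => rw [map_zero]; exact zero_mem _
    | add p q hp hq => rw [map_add]; exact add_mem hp hq
    | single s c =>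
      rw [segreCone.toMvPolynomial_single]
      exact monomial_mem_segreRing K _ s.1 s.2 rfl c
  · refine Algebra.adjoin_le ?_
    rintro _ ⟨⟨i, j⟩, rfl⟩
    refine ⟨AddMonoidAlgebra.single ⟨_, single_add_single_mem_segreCone i j⟩ 1, ?_⟩
    refine (segreCone.toMvPolynomial_single K _ _).trans ?_
    simp [MvPolynomial.X, MvPolynomial.monomial_mul]

/-- The Segre ring is the monoid algebra of the Segre cone. -/
noncomputable def segreConeEquiv : AddMonoidAlgebra K (segreCone a b) ≃ₐ[K] segreRing K a b :=
  (AlgEquiv.ofInjective _ (segreCone.toMvPolynomial_injective K)).trans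
    (Subalgebra.equivOfEq _ _ (segreCone.range_toMvPolynomial K))

theorem coe_segreConeEquiv (p : AddMonoidAlgebra K (segreCone a b)) :
    (segreConeEquiv K p : MvPolynomial (Fin a ⊕ Fin b) K) = segreCone.toMvPolynomial K p := rfl

/-- The inclusion of the Segre cone into the lattice of exponents. -/
def segreCone.toLattice : segreCone a b →+ segreLattice a b where
  toFun s := ⟨fun l => s.1 l, by
    have := s.2
    rw [mem_segreCone] at this
    rw [mem_segreLattice]
    exact_mod_cast this⟩
  map_zero' := by ext; simp
  map_add' s t := by ext; simp

theorem segreCone.toLattice_apply (s : segreCone a b) (l : Fin a ⊕ Fin b) :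
    (segreCone.toLattice s).1 l = s.1 l := rfl

theorem segreCone.toLattice_injective :
    Function.Injective (segreCone.toLattice (a := a) (b := b)) := by
  intro s t h
  ext l
  have := congr_fun (congrArg Subtype.val h) l
  simpa [segreCone.toLattice_apply] using this

/-- The inclusion of the Segre ring into its ring of Laurent polynomials. -/
noncomputable def segreRing.toLaurent :
    segreRing K a b →ₐ[K] AddMonoidAlgebra K (segreLattice a b) :=
  (AddMonoidAlgebra.mapDomainAlgHom K K segreCone.toLattice).comp
    (segreConeEquiv K).symm.toAlgHom

namespace segreRing

theorem toLaurent_equiv (p : AddMonoidAlgebra K (segreCone a b)) :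
    toLaurent K (segreConeEquiv K p) = AddMonoidAlgebra.mapDomain segreCone.toLattice p := by
  simp [toLaurent]

theorem toLaurent_injective : Function.Injective (toLaurent K (a := a) (b := b)) := by
  intro r s h
  obtain ⟨p, rfl⟩ := (segreConeEquiv K).surjective r
  obtain ⟨q, rfl⟩ := (segreConeEquiv K).surjective s
  rw [toLaurent_equiv, toLaurent_equiv] at h
  rw [AddMonoidAlgebra.mapDomain_injective segreCone.toLattice_injective h]

theorem toLaurent_xy (i : Fin a) (j : Fin b) :
    toLaurent K (xy K i j) = AddMonoidAlgebra.single
      (segreCone.toLattice ⟨_, single_add_single_mem_segreCone i j⟩) 1 := by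
  have : xy K i j = segreConeEquiv K
      (AddMonoidAlgebra.single ⟨_, single_add_single_mem_segreCone i j⟩ 1) := by
    ext1
    rw [coe_segreConeEquiv, segreCone.toMvPolynomial_single]
    simp [xy, MvPolynomial.X, MvPolynomial.monomial_mul]
  rw [this, toLaurent_equiv, AddMonoidAlgebra.mapDomain_single]

theorem nonneg_of_coeff_toLaurent_ne_zero (r : segreRing K a b) (w : segreLattice a b)
    (h : (toLaurent K r).coeff w ≠ 0) (l : Fin a ⊕ Fin b) : 0 ≤ w.1 l := by
  obtain ⟨p, rfl⟩ := (segreConeEquiv K).surjective r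
  rw [toLaurent_equiv] at h
  induction p using AddMonoidAlgebra.induction_linear with
  | zero => simp at h
  | add p q hp hq =>
    rw [AddMonoidAlgebra.mapDomain_add, AddMonoidAlgebra.coeff_add, Finsupp.add_apply] at h
    by_cases h0 : (AddMonoidAlgebra.mapDomain segreCone.toLattice p).coeff w = 0
    · rw [h0, zero_add] at h
      exact hq h
    · exact hp h0
  | single s c =>
    rw [AddMonoidAlgebra.mapDomain_single, AddMonoidAlgebra.coeff_single] at h
    obtain ⟨rfl, -⟩ := Finsupp.single_apply_ne_zero.1 h
    rw [segreCone.toLattice_apply]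
    positivity

theorem exists_toLaurent_eq_single (w : segreLattice a b) (hw : ∀ l, 0 ≤ w.1 l) (c : K) :
    ∃ r, toLaurent K r = AddMonoidAlgebra.single w c := by
  have hs : (Finsupp.equivFunOnFinite.symm fun l => (w.1 l).toNat) ∈ segreCone a b := by
    have := mem_segreLattice.1 w.2
    rw [mem_segreCone]
    zify
    simpa [hw] using this
  refine ⟨segreConeEquiv K (AddMonoidAlgebra.single ⟨_, hs⟩ c), ?_⟩
  rw [toLaurent_equiv, AddMonoidAlgebra.mapDomain_single]
  congr 1
  ext l
  simp [segreCone.toLattice_apply, hw]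

end segreRing

theorem segreLattice.exists_nsmul_add_nonneg (v w : segreLattice a b) (hv : ∀ l, 0 ≤ v.1 l)
    (h : ∀ l, v.1 l = 0 → 0 ≤ w.1 l) : ∃ N : ℕ, ∀ l, 0 ≤ (N • v + w).1 l := by
  refine ⟨(∑ l, |w.1 l|).toNat, fun l => ?_⟩
  have h1 : |w.1 l| ≤ ∑ l, |w.1 l| :=
    Finset.single_le_sum (f := fun l => |w.1 l|) (fun _ _ => abs_nonneg _) (Finset.mem_univ l)
  have h2 := neg_abs_le (w.1 l)
  have h3 : (((∑ l, |w.1 l|).toNat : ℕ) : ℤ) = ∑ l, |w.1 l| :=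
    Int.toNat_of_nonneg (by positivity)
  change 0 ≤ (∑ l, |w.1 l|).toNat • v.1 l + w.1 l
  rw [nsmul_eq_mul, h3]
  rcases (hv l).eq_or_lt with h0 | h0
  · rw [← h0]
    have := h l h0.symm
    linarith
  · nlinarith [abs_nonneg (w.1 l)]

theorem segreLattice.exists_pos (ha : 0 < a) (hb : 0 < b) :
    ∃ v : segreLattice a b, ∀ l, 0 < v.1 l :=
  ⟨⟨Sum.elim (fun _ => b) fun _ => a, by simp [mem_segreLattice, mul_comm]⟩, fun l => by
    rcases l with i | j <;> simpa⟩

/-- Provides a monomial of R that vanishes on every coordinate divisor except the one of l. For l =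
x_i the witness has x-degree (a - 1)b and y-degree b(a - 1); positivity of a - 1 uses 1 < a. -/
theorem segreLattice.exists_face (ha : 1 < a) (hb : 1 < b) (l : Fin a ⊕ Fin b) :
    ∃ v : segreLattice a b, v.1 l = 0 ∧ ∀ l', l' ≠ l → 0 < v.1 l' := by
  rcases l with i | j
  · refine ⟨⟨Sum.elim (fun i' => if i' = i then 0 else b) fun _ => a - 1, ?_⟩, by simp, ?_⟩
    · simp [mem_segreLattice, Finset.sum_ite, Finset.filter_ne']
      rw [Nat.cast_sub (by omega)]
      push_cast
      ring
    · rintro (i' | j') h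
      · have : i' ≠ i := fun e => h (by rw [e])
        simp [this]; omega
      · simp; omega
  · refine ⟨⟨Sum.elim (fun _ => b - 1) fun j' => if j' = j then 0 else a, ?_⟩, by simp, ?_⟩
    · simp [mem_segreLattice, Finset.sum_ite, Finset.filter_ne']
      rw [Nat.cast_sub (by omega)]
      push_cast
      ring
    · rintro (i' | j') h
      · simp; omega
      · have : j' ≠ j := fun e => h (by rw [e])
        simp [this]; omega

/-! ### Pole orders and the forced roots -/

namespace segreRing

theorem isUnit_single (w : segreLattice a b) :
    IsUnit (AddMonoidAlgebra.single w (1 : K)) :=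
  IsUnit.of_mul_eq_one (AddMonoidAlgebra.single (-w) (1 : K)) (by
    rw [AddMonoidAlgebra.single_mul_single, add_neg_cancel, mul_one]; rfl)

theorem toLaurent_isFractions (ha : 0 < a) (hb : 0 < b) :
    IsFractions (toLaurent K (a := a) (b := b)) := by
  refine ⟨toLaurent_injective K, fun z => ?_⟩
  obtain ⟨v, hv⟩ := segreLattice.exists_pos ha hb
  suffices H : ∃ w : segreLattice a b, (∀ l, 0 ≤ w.1 l) ∧
      ∃ h, AddMonoidAlgebra.single w (1 : K) * z = toLaurent K h by
    obtain ⟨w, hw, h, e⟩ := H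
    obtain ⟨g, hg⟩ := exists_toLaurent_eq_single K w hw 1
    exact ⟨g, h, hg ▸ isUnit_single K w, by rw [hg, e]⟩
  induction z using AddMonoidAlgebra.induction_linear with
  | zero => exact ⟨0, by simp, 0, by simp⟩
  | add z z' hz hz' =>
    obtain ⟨w, hw, h, e⟩ := hz
    obtain ⟨w', hw', h', e'⟩ := hz'
    obtain ⟨g, hg⟩ := exists_toLaurent_eq_single K w hw 1
    obtain ⟨g', hg'⟩ := exists_toLaurent_eq_single K w' hw' 1
    refine ⟨w + w', fun l => add_nonneg (hw l) (hw' l), g' * h + g * h', ?_⟩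
    have e1 : AddMonoidAlgebra.single (w + w') (1 : K)
        = AddMonoidAlgebra.single w 1 * AddMonoidAlgebra.single w' 1 := by
      rw [AddMonoidAlgebra.single_mul_single, mul_one]
    rw [map_add, map_mul, map_mul, hg, hg', ← e, ← e', e1]
    ring
  | single w c =>
    obtain ⟨N, hN⟩ := segreLattice.exists_nsmul_add_nonneg v w (fun l => (hv l).le)
      fun l hl => absurd hl (hv l).ne'
    obtain ⟨h, hh⟩ := exists_toLaurent_eq_single K _ hN c
    refine ⟨N • v, fun l => ?_, h, by rw [hh, AddMonoidAlgebra.single_mul_single, one_mul]⟩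
    simpa using mul_nonneg (Nat.cast_nonneg N) (hv l).le

/-- Differential operators on the Segre ring, extended to Laurent polynomials, do not create
poles: an exponent that is nonnegative on a monomial stays nonnegative on its image. -/
theorem nonneg_of_coeff_diffOpExt_ne_zero (ha : 1 < a) (hb : 1 < b)
    (hι : IsFractions (toLaurent K (a := a) (b := b))) (δ : diffOpRing K (segreRing K a b))
    (w w' : segreLattice a b)
    (h : ((diffOpExt hι δ).1 (AddMonoidAlgebra.single w 1)).coeff w' ≠ 0)
    (l : Fin a ⊕ Fin b) (hl : 0 ≤ w.1 l) : 0 ≤ w'.1 l := by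
  obtain ⟨v, hv0, hv⟩ := segreLattice.exists_face ha hb l
  have hv' : ∀ l', 0 ≤ v.1 l' := fun l' => by
    by_cases e : l' = l
    · rw [e, hv0]
    · exact (hv l' e).le
  obtain ⟨N, hN⟩ := segreLattice.exists_nsmul_add_nonneg v w hv' fun l' hl' => by
    by_cases e : l' = l
    · rwa [e]
    · exact absurd hl' (hv l' e).ne'
  obtain ⟨g, hg⟩ := exists_toLaurent_eq_single K (N • v)
    (fun l' => by simpa using mul_nonneg (Nat.cast_nonneg N) (hv' l')) 1
  obtain ⟨r, hr⟩ := exists_toLaurent_eq_single K _ hN 1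
  -- Laurent polynomials without pole along l. Division by g preserves V because g has exponent 0 at
  -- l.
  let V : AddSubgroup (AddMonoidAlgebra K (segreLattice a b)) :=
    { carrier := {z | ∀ u : segreLattice a b, z.coeff u ≠ 0 → 0 ≤ u.1 l}
      zero_mem' := by simp
      add_mem' := fun {z z'} hz hz' u hu => by
        by_cases h0 : z.coeff u = 0
        · exact hz' u (by simpa [h0] using hu)
        · exact hz u h0
      neg_mem' := fun {z} hz u hu => hz u (by simpa using hu) }
  obtain ⟨n, hn⟩ := (diffOpExt hι δ).2
  refine diffOp_apply_mem V (fun r u hu => nonneg_of_coeff_toLaurent_ne_zero K r u hu l)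
    (g := g) (r := r) ?_ ?_ n δ.1 _ hn (diffOpExt_apply hι δ) w' h
  · rw [hg, hr, AddMonoidAlgebra.single_mul_single, mul_one]
  · intro x hx u hu
    have := hx (N • v + u) (by rw [hg]; simpa using hu)
    simpa [hv0] using this

/-- A criterion for `n` to be a root of every polynomial in a sandwich Bernstein–Sato equation
of `x_i y_j`: there is a monomial such that no composite path from it through `f ^ (n + 1)` reaches
its product with `f ^ n`. -/
theorem eval_eq_zero_of_satisfiesSBSEquation (ha : 1 < a) (hb : 1 < b) (i : Fin a) (j : Fin b)
    {c : K[X]} (hc : SatisfiesSBSEquation K (xy K i j) c) (n : ℤ) (w : segreLattice a b)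
    (hw : ∀ w₁ : segreLattice a b,
      (∀ l, 0 ≤ w.1 l → 0 ≤
        w₁.1 l - (n + 1) * Sum.elim (Pi.single i 1) (Pi.single j 1) l) →
      ∃ l, 0 ≤ w₁.1 l ∧
        w.1 l + n * Sum.elim (Pi.single i 1) (Pi.single j 1) l < 0) :
    c.eval (n : K) = 0 := by
  have hι := toLaurent_isFractions K (a := a) (b := b) (by omega) (by omega)
  set v : segreLattice a b := segreCone.toLattice ⟨_, single_add_single_mem_segreCone i j⟩ with hv
  have hvl : ∀ l, v.1 l = Sum.elim (Pi.single i 1) (Pi.single j 1) l := fun l => by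
    rw [hv, segreCone.toLattice_apply]
    rcases l with k | k <;> simp [Finsupp.single_apply, Pi.single_apply, eq_comm]
  let φ : Multiplicative (segreLattice a b) →* (AddMonoidAlgebra K (segreLattice a b))ˣ :=
    (Units.map (AddMonoidAlgebra.of K (segreLattice a b))).comp toUnits.toMonoidHom
  have hφ : ∀ m : ℤ, ((φ (Multiplicative.ofAdd v) ^ m :
      (AddMonoidAlgebra K (segreLattice a b))ˣ) : AddMonoidAlgebra K (segreLattice a b))
      = AddMonoidAlgebra.single (m • v) 1 := fun m => by
    rw [← map_zpow]
    rfl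
  obtain ⟨t, α, β, h⟩ := hc.exists_int hι (u := φ (Multiplicative.ofAdd v)) (by
    rw [toLaurent_xy]; rfl) n
  -- Apply the equation at n to the monomial of exponent w and compare coefficients at w + n v: the
  -- right side gives c(n), and every summand on the left is shown to contribute zero.
  have h1 := congrArg (fun z => z.coeff (n • v + w)) (h (AddMonoidAlgebra.single w 1))
  simp only [hφ] at h1
  rw [AddMonoidAlgebra.single_mul_single] at h1
  simp only [AddMonoidAlgebra.coeff_smul, Finsupp.smul_apply, AddMonoidAlgebra.coeff_single,
    Finsupp.single_eq_same, mul_one, smul_eq_mul] at h1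
  rw [← h1, AddMonoidAlgebra.coeff_sum, Finset.sum_apply']
  refine Finset.sum_eq_zero fun k _ => ?_
  set y := AddMonoidAlgebra.single ((n + 1) • v) (1 : K) *
    (diffOpExt hι (β k)).1 (AddMonoidAlgebra.single w 1) with hy
  have hysum : y = ∑ w₁ ∈ y.coeff.support, y.coeff w₁ • AddMonoidAlgebra.single w₁ (1 : K) := by
    conv_lhs => rw [← AddMonoidAlgebra.sum_coeff_single y]
    simp [Finsupp.sum]
  rw [hysum, map_sum, AddMonoidAlgebra.coeff_sum, Finset.sum_apply']
  refine Finset.sum_eq_zero fun w₁ hw₁ => ?_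
  rw [map_smul, AddMonoidAlgebra.coeff_smul_apply]
  by_contra hne
  have hne' := right_ne_zero_of_smul hne
  rw [Finsupp.mem_support_iff, hy, AddMonoidAlgebra.coeff_single_mul_apply, one_mul] at hw₁
  obtain ⟨l, hl, hneg⟩ := hw w₁ fun l hl => by
    have := nonneg_of_coeff_diffOpExt_ne_zero K ha hb hι _ _ _ hw₁ l hl
    simp [hvl] at this
    linarith
  have := nonneg_of_coeff_diffOpExt_ne_zero K ha hb hι _ _ _ hne' l hl
  simp [hvl] at this
  linarith

/-- At n = -1 the middle factor is 1, and the operators cannot take 1 to f⁻¹, which has a pole along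
x_i. -/
theorem eval_neg_one_of_satisfiesSBSEquation (ha : 1 < a) (hb : 1 < b) (i : Fin a) (j : Fin b)
    {c : K[X]} (hc : SatisfiesSBSEquation K (xy K i j) c) : c.eval (-1) = 0 := by
  have := eval_eq_zero_of_satisfiesSBSEquation K ha hb i j hc (-1) 0 fun w₁ h =>
    ⟨Sum.inl i, by simpa using h (Sum.inl i), by simp⟩
  simpa using this

/-- The start is x_i^a / (x_1 ⋯ x_a), and the target has exponent -1 at every x. To reach it, the
intermediate exponent w₁ must be negative at every x, so its x-degree is at most -a. The start has
no pole along any y, so after multiplication by f^(1-a) the y-degree of w₁ is at least 1 - a. The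
two degrees are equal, a contradiction. -/
theorem eval_neg_left_of_satisfiesSBSEquation (ha : 1 < a) (hb : 1 < b) (i : Fin a) (j : Fin b)
    {c : K[X]} (hc : SatisfiesSBSEquation K (xy K i j) c) : c.eval (-(a : K)) = 0 := by
  have := eval_eq_zero_of_satisfiesSBSEquation K ha hb i j hc (-a)
    ⟨Sum.elim (a • Pi.single i 1 - 1) 0, by simp [mem_segreLattice, Pi.single_apply]⟩ fun w₁ h => by
      by_contra! H
      have h1 := mem_segreLattice.1 w₁.2
      have h2 : ∑ k, w₁.1 (Sum.inl k) ≤ ∑ k : Fin a, (-1 : ℤ) := Finset.sum_le_sum fun k _ => by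
        by_contra! h0
        -- The target exponent is a - 1 - a = -1 for k = i and -1 - 0 = -1 otherwise.
        have := H (Sum.inl k) (by omega)
        by_cases hk : k = i <;> simp [hk] at this
      have h3 : ∑ k : Fin b, (1 - (a : ℤ)) * Pi.single (M := fun _ => ℤ) j 1 k
          ≤ ∑ k, w₁.1 (Sum.inr k) := Finset.sum_le_sum fun k _ => by
        have := h (Sum.inr k) (by simp)
        simp only [Sum.elim_inr] at this
        linarith
      rw [← Finset.mul_sum] at h3
      simp at h2 h3
      omega
  simpa using this

theorem eval_neg_right_of_satisfiesSBSEquation (ha : 1 < a) (hb : 1 < b) (i : Fin a) (j : Fin b)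
    {c : K[X]} (hc : SatisfiesSBSEquation K (xy K i j) c) : c.eval (-(b : K)) = 0 := by
  have := eval_eq_zero_of_satisfiesSBSEquation K ha hb i j hc (-b)
    ⟨Sum.elim 0 (b • Pi.single j 1 - 1), by simp [mem_segreLattice, Pi.single_apply]⟩ fun w₁ h => by
      by_contra! H
      have h1 := mem_segreLattice.1 w₁.2
      have h2 : ∑ k, w₁.1 (Sum.inr k) ≤ ∑ k : Fin b, (-1 : ℤ) := Finset.sum_le_sum fun k _ => by
        by_contra! h0
        have := H (Sum.inr k) (by omega)
        by_cases hk : k = j <;> simp [hk] at this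
      have h3 : ∑ k : Fin a, (1 - (b : ℤ)) * Pi.single (M := fun _ => ℤ) i 1 k
          ≤ ∑ k, w₁.1 (Sum.inl k) := Finset.sum_le_sum fun k _ => by
        have := h (Sum.inl k) (by simp)
        simp only [Sum.elim_inl] at this
        linarith
      rw [← Finset.mul_sum] at h3
      simp at h2 h3
      omega
  simpa using this

end segreRing

end Segre

/-! ### Closure properties of sandwiches -/

section Sandwich

variable {K R : Type*} [Field K] [CommRing R] [Algebra K R]

/-- `Θ n` is a sandwich `∑ᵢ αᵢ(n) f^{n+1} βᵢ(n)` with `αᵢ(s), βᵢ(s) ∈ D_{R|K}[s]`. -/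
def IsSandwich (f : R) (Θ : ℕ → diffOpRing K R) : Prop :=
  ∃ (t : ℕ) (α β : Fin t → (diffOpRing K R)[X]), ∀ n : ℕ,
    ∑ i, (α i).eval (n : diffOpRing K R) * diffOpRing.mulBy K f ^ (n + 1)
        * (β i).eval (n : diffOpRing K R) = Θ n

namespace IsSandwich

variable {f : R} {Θ Θ' : ℕ → diffOpRing K R}

theorem mul_mul (δ ε : diffOpRing K R) :
    IsSandwich f fun n => δ * diffOpRing.mulBy K f ^ (n + 1) * ε :=
  ⟨1, fun _ => C δ, fun _ => C ε, fun n => by simp⟩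

theorem zero : IsSandwich f fun _ => (0 : diffOpRing K R) :=
  ⟨0, Fin.elim0, Fin.elim0, fun n => by simp⟩

theorem add (h : IsSandwich f Θ) (h' : IsSandwich f Θ') : IsSandwich f fun n => Θ n + Θ' n := by
  obtain ⟨t, α, β, h⟩ := h
  obtain ⟨t', α', β', h'⟩ := h'
  refine ⟨t + t', Fin.append α α', Fin.append β β', fun n => ?_⟩
  rw [Fin.sum_univ_add]
  simp only [Fin.append_left, Fin.append_right, h, h']

theorem smul (k : K[X]) (h : IsSandwich f Θ) : IsSandwich f fun n => k.eval (n : K) • Θ n := by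
  obtain ⟨t, α, β, h⟩ := h
  refine ⟨t, fun i => k.map (algebraMap K (diffOpRing K R)) * α i, β, fun n => ?_⟩
  have key : ∀ i, (k.map (algebraMap K (diffOpRing K R)) * α i).eval (n : diffOpRing K R)
      = k.eval (n : K) • (α i).eval (n : diffOpRing K R) := by
    intro i
    rw [eval, eval₂_mul_noncomm _ _ fun _ => Nat.commute_cast _ _, ← eval, ← eval,
      eval_natCast_map, Algebra.smul_def]
  simp only [key, smul_mul_assoc]
  rw [← Finset.smul_sum, h]

theorem sub (h : IsSandwich f Θ) (h' : IsSandwich f Θ') : IsSandwich f fun n => Θ n - Θ' n := by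
  have := h.add (h'.smul (-1))
  convert this using 2 with n
  refine Subtype.ext ?_
  simp [sub_eq_add_neg]

theorem sum {ι : Type*} (s : Finset ι) {Θ : ι → ℕ → diffOpRing K R}
    (h : ∀ i ∈ s, IsSandwich f (Θ i)) : IsSandwich f fun n => ∑ i ∈ s, Θ i n := by
  classical
  induction s using Finset.induction_on with
  | empty => simpa using zero
  | insert i s hi ih =>
    simp only [Finset.sum_insert hi]
    exact (h i (by simp)).add (ih fun j hj => h j (by simp [hj]))

end IsSandwich

end Sandwich

/-! ### Restricting differential operators to invariant subalgebras -/

section Restriction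

variable {A S : Type*} [CommRing A] [CommRing S] [Algebra A S]

theorem Derivation.toLinearMap_mem_diffOpRing (D : Derivation A S S) :
    (D : Module.End A S) ∈ diffOpRing A S := by
  refine ⟨1, fun r => ?_⟩
  convert mulLeft_mem_diffOpOrder_zero (A := A) (D r) using 1
  ext x
  simp [mul_comm]

/-- The restriction of an endomorphism to an invariant subalgebra. -/
def Subalgebra.restrictEnd (T : Subalgebra A S) (δ : Module.End A S) (h : ∀ p ∈ T, δ p ∈ T) :
    Module.End A T where
  toFun x := ⟨δ x, h x x.2⟩
  map_add' x y := by ext; simp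
  map_smul' c x := by ext; simp

theorem Subalgebra.restrictEnd_mem_diffOpOrder (T : Subalgebra A S) (n : ℕ) :
    ∀ (δ : Module.End A S) (h : ∀ p ∈ T, δ p ∈ T), δ ∈ diffOpOrder A S n →
      T.restrictEnd δ h ∈ diffOpOrder A T n := by
  induction n with
  | zero =>
    intro δ h hδ r x
    ext
    exact hδ r x
  | succ n ih =>
    intro δ h hδ r
    refine ih (δ * LinearMap.mulLeft A (r : S) - LinearMap.mulLeft A (r : S) * δ)
      (fun p hp => sub_mem (h _ (mul_mem r.2 hp)) (mul_mem r.2 (h p hp))) (hδ r)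

/-- The restriction of a differential operator to an invariant subalgebra. -/
def diffOpRing.restrict (T : Subalgebra A S) (δ : Module.End A S) (hδ : δ ∈ diffOpRing A S)
    (h : ∀ p ∈ T, δ p ∈ T) : diffOpRing A T :=
  ⟨T.restrictEnd δ h, hδ.imp fun n hn => T.restrictEnd_mem_diffOpOrder n δ h hn⟩

end Restriction

/-! ### The Euler identity behind the factors s + a and s + b -/

section Derivations

variable {A S I J : Type*} [CommRing A] [CommRing S] [Algebra A S] [Fintype I] [Fintype J]
  [DecidableEq I] [DecidableEq J]

/-- Here p and q play the roles of the x- and y-derivatives, and m is the y-degree of G. Put u = q_j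
h, and let θ_x, θ_y be the Euler operators. Since h has equal degrees, θ_y u = θ_x u - u, so ∑ q_k(G
y_k u) = (m - 1 + |J|) G u + G θ_x u. Applying p_i, the subtracted sum cancels everything coming
from G θ_x u except G p_i u, which arises from p_i θ_x = θ_x p_i + p_i. -/
theorem sum_sub_sum_derivation_sandwich (p : I → Derivation A S S) (q : J → Derivation A S S)
    (x : I → S) (y : J → S)
    (hpx : ∀ i k, p i (x k) = if k = i then 1 else 0)
    (hqy : ∀ j k, q j (y k) = if k = j then 1 else 0)
    (hqx : ∀ j k, q j (x k) = 0)
    (hpp : ∀ i k s, p i (p k s) = p k (p i s)) (hqq : ∀ i k s, q i (q k s) = q k (q i s))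
    (hpq : ∀ i k s, q i (p k s) = p k (q i s)) (i : I) (j : J) (G h m : S)
    (hG : ∑ k, y k * q k G = m * G) (hm : p i m = 0)
    (hh : ∑ k, x k * p k h = ∑ k, y k * q k h) :
    ∑ k, p i (q k (G * (y k * q j h))) - ∑ k, x k * p i (G * p k (q j h))
      = (m - 1 + Fintype.card J) * p i (G * q j h) + G * p i (q j h) := by
  have e1 : ∑ k, y k * q k (q j h) = ∑ k, x k * p k (q j h) - q j h := by
    have := congrArg (q j) hh
    simp only [map_sum, Derivation.leibniz, smul_eq_mul, hqx, hqy, mul_zero, add_zero, mul_ite,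
      mul_one, Finset.sum_add_distrib, Finset.sum_ite_eq', Finset.mem_univ, if_true] at this
    simp only [← hpq, hqq _ j, this]
    ring
  have e2 : ∑ k, q k (G * (y k * q j h))
      = (m - 1 + Fintype.card J) * (G * q j h) + G * ∑ k, x k * p k (q j h) := by
    have e3 : ∀ k, q k (G * (y k * q j h))
        = (y k * q k G) * q j h + G * q j h + G * (y k * q k (q j h)) := fun k => by
      simp [hqy]
      ring
    simp only [e3, Finset.sum_add_distrib, ← Finset.sum_mul, ← Finset.mul_sum, hG, e1]
    simp
    ring
  have e4 : p i (∑ k, x k * p k (q j h)) = p i (q j h) + ∑ k, x k * p k (p i (q j h)) := by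
    simp only [map_sum, Derivation.leibniz, smul_eq_mul, hpx, mul_ite, mul_one, mul_zero,
      Finset.sum_add_distrib, Finset.sum_ite_eq', Finset.mem_univ, if_true, hpp i]
    ring
  have e5 : ∑ k, x k * p i (G * p k (q j h))
      = p i G * ∑ k, x k * p k (q j h) + G * ∑ k, x k * p k (p i (q j h)) := by
    rw [Finset.mul_sum, Finset.mul_sum, ← Finset.sum_add_distrib]
    refine Finset.sum_congr rfl fun k _ => ?_
    simp [hpp i]
    ring
  have e6 : p i (m - 1 + Fintype.card J) = 0 := by simp [hm]
  rw [← map_sum, e2, e5, map_add, (p i).leibniz, (p i).leibniz G (∑ k, _), e4, e6]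
  simp only [smul_eq_mul]
  ring

end Derivations

/-! ### Explicit operators on the Segre ring and the functional equation -/

section SegreOperators

variable (K : Type*) [Field K] {a b : ℕ}

open MvPolynomial in
theorem MvPolynomial.pderiv_pderiv_comm {σ R : Type*} [CommRing R] (i j : σ)
    (p : MvPolynomial σ R) : pderiv i (pderiv j p) = pderiv j (pderiv i p) := by
  induction p using MvPolynomial.induction_on' with
  | add p q hp hq => simp only [map_add, hp, hq]
  | monomial s c =>
    rcases eq_or_ne i j with rfl | hij
    · rfl
    · simp only [pderiv_monomial, Finsupp.tsub_apply, Finsupp.single_eq_of_ne hij,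
        Finsupp.single_eq_of_ne hij.symm, tsub_zero]
      rw [tsub_right_comm, mul_right_comm]

/-- The grading whose degree-zero part is the Segre ring. -/
def segreWeight (a b : ℕ) : Fin a ⊕ Fin b → ℤ := Sum.elim (fun _ => 1) fun _ => -1

theorem weight_segreWeight_eq_zero_iff (s : Fin a ⊕ Fin b →₀ ℕ) :
    Finsupp.weight (segreWeight a b) s = 0 ↔ s ∈ segreCone a b := by
  rw [mem_segreCone, Finsupp.weight_apply, Finsupp.sum_fintype _ _ (by simp),
    Fintype.sum_sum_type]
  simp only [segreWeight, Sum.elim_inl, Sum.elim_inr]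
  simp [add_neg_eq_zero]
  norm_cast

/-- Used to check that an operator of weight zero on the polynomial ring preserves the Segre ring.
-/
theorem mem_segreRing_iff {p : MvPolynomial (Fin a ⊕ Fin b) K} :
    p ∈ segreRing K a b ↔ p.IsWeightedHomogeneous (segreWeight a b) 0 := by
  constructor
  · intro hp
    refine Algebra.adjoin_induction ?_ (fun c => MvPolynomial.isWeightedHomogeneous_C _ c)
      (fun _ _ _ _ => .add) (fun p q _ _ hp hq => by simpa using hp.mul hq) hp
    rintro _ ⟨⟨i, j⟩, rfl⟩
    simpa [segreWeight] using (MvPolynomial.isWeightedHomogeneous_X K (segreWeight a b)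
      (Sum.inl i)).mul (MvPolynomial.isWeightedHomogeneous_X K (segreWeight a b) (Sum.inr j))
  · intro hp
    rw [p.as_sum]
    refine sum_mem fun s hs => monomial_mem_segreRing K _ s ?_ rfl _
    rw [← weight_segreWeight_eq_zero_iff]
    exact hp (MvPolynomial.mem_support_iff.1 hs)

theorem Derivation.finset_sum_apply {A S ι : Type*} [CommRing A] [CommRing S] [Algebra A S]
    (s : Finset ι) (D : ι → Derivation A S S) (x : S) : (∑ i ∈ s, D i) x = ∑ i ∈ s, D i x := by
  classical
  induction s using Finset.induction_on with
  | empty => simp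
  | insert i s hi ih => rw [Finset.sum_insert hi, Finset.sum_insert hi, Derivation.add_apply, ih]

theorem pderiv_X_eq_ite {σ R : Type*} [DecidableEq σ] [CommSemiring R] (i k : σ) :
    MvPolynomial.pderiv i (MvPolynomial.X k : MvPolynomial σ R) = if k = i then 1 else 0 := by
  split_ifs with h
  · rw [h, MvPolynomial.pderiv_X_self]
  · exact MvPolynomial.pderiv_X_of_ne h

theorem sum_X_mul_pderiv_eq_of_mem_segreRing {p : MvPolynomial (Fin a ⊕ Fin b) K}
    (hp : p ∈ segreRing K a b) :
    ∑ i, MvPolynomial.X (Sum.inl i) * MvPolynomial.pderiv (Sum.inl i) p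
      = ∑ j, MvPolynomial.X (Sum.inr j) * MvPolynomial.pderiv (Sum.inr j) p := by
  let Dx : Derivation K (MvPolynomial (Fin a ⊕ Fin b) K) (MvPolynomial (Fin a ⊕ Fin b) K) :=
    ∑ i : Fin a, (MvPolynomial.X (Sum.inl i) : MvPolynomial (Fin a ⊕ Fin b) K) •
      MvPolynomial.pderiv (R := K) (Sum.inl i)
  let Dy : Derivation K (MvPolynomial (Fin a ⊕ Fin b) K) (MvPolynomial (Fin a ⊕ Fin b) K) :=
    ∑ j : Fin b, (MvPolynomial.X (Sum.inr j) : MvPolynomial (Fin a ⊕ Fin b) K) •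
      MvPolynomial.pderiv (R := K) (Sum.inr j)
  have hDx : ∀ q : MvPolynomial (Fin a ⊕ Fin b) K, Dx q =
      ∑ i, MvPolynomial.X (Sum.inl i) * MvPolynomial.pderiv (Sum.inl i) q :=
    fun q => by simp only [Dx, Derivation.finset_sum_apply, Derivation.smul_apply, smul_eq_mul]
  have hDy : ∀ q : MvPolynomial (Fin a ⊕ Fin b) K, Dy q =
      ∑ j, MvPolynomial.X (Sum.inr j) * MvPolynomial.pderiv (Sum.inr j) q :=
    fun q => by simp only [Dy, Derivation.finset_sum_apply, Derivation.smul_apply, smul_eq_mul]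
  rw [← hDx, ← hDy]
  refine Derivation.eqOn_adjoin ?_ hp
  rintro _ ⟨⟨i, j⟩, rfl⟩
  simp [hDx, hDy, pderiv_X_eq_ite, -MvPolynomial.pderiv_X]
  ring

namespace segreRing

open MvPolynomial (pderiv IsWeightedHomogeneous)

/-- The operator `∂_{x_i} ∂_{y_j}`. -/
noncomputable def pderivPderiv (i : Fin a) (j : Fin b) : diffOpRing K (segreRing K a b) :=
  diffOpRing.restrict _ ((pderiv (Sum.inl i)).toLinearMap * (pderiv (Sum.inr j)).toLinearMap)
    (mul_mem (pderiv _).toLinearMap_mem_diffOpRing (pderiv _).toLinearMap_mem_diffOpRing)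
    fun p hp => by
      rw [mem_segreRing_iff] at hp ⊢
      exact (hp.pderiv (n' := 1) (by simp [segreWeight])).pderiv (by simp [segreWeight])

/-- The operator `x_k ∂_{x_i}`. -/
noncomputable def xPderiv (k i : Fin a) : diffOpRing K (segreRing K a b) :=
  diffOpRing.restrict _
    (LinearMap.mulLeft K (MvPolynomial.X (Sum.inl k)) * (pderiv (Sum.inl i)).toLinearMap)
    (mul_mem ⟨0, mulLeft_mem_diffOpOrder_zero _⟩ (pderiv _).toLinearMap_mem_diffOpRing)
    fun p hp => by
      rw [mem_segreRing_iff] at hp ⊢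
      have := (MvPolynomial.isWeightedHomogeneous_X K (segreWeight a b) (Sum.inl k)).mul
        (hp.pderiv (i := Sum.inl i) (n' := -1) (by simp [segreWeight]))
      simpa [segreWeight] using this

/-- The operator `y_k ∂_{y_j}`. -/
noncomputable def yPderiv (k j : Fin b) : diffOpRing K (segreRing K a b) :=
  diffOpRing.restrict _
    (LinearMap.mulLeft K (MvPolynomial.X (Sum.inr k)) * (pderiv (Sum.inr j)).toLinearMap)
    (mul_mem ⟨0, mulLeft_mem_diffOpOrder_zero _⟩ (pderiv _).toLinearMap_mem_diffOpRing)
    fun p hp => by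
      rw [mem_segreRing_iff] at hp ⊢
      have := (MvPolynomial.isWeightedHomogeneous_X K (segreWeight a b) (Sum.inr k)).mul
        (hp.pderiv (i := Sum.inr j) (n' := 1) (by simp [segreWeight]))
      simpa [segreWeight] using this

theorem coe_pderivPderiv_apply (i : Fin a) (j : Fin b) (h : segreRing K a b) :
    ((pderivPderiv K i j).1 h : MvPolynomial (Fin a ⊕ Fin b) K)
      = pderiv (Sum.inl i) (pderiv (Sum.inr j) (h : MvPolynomial (Fin a ⊕ Fin b) K)) := rfl

theorem coe_xPderiv_apply (k i : Fin a) (h : segreRing K a b) :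
    ((xPderiv K k i).1 h : MvPolynomial (Fin a ⊕ Fin b) K)
      = MvPolynomial.X (Sum.inl k)
        * pderiv (Sum.inl i) (h : MvPolynomial (Fin a ⊕ Fin b) K) := rfl

theorem coe_yPderiv_apply (k j : Fin b) (h : segreRing K a b) :
    ((yPderiv K k j).1 h : MvPolynomial (Fin a ⊕ Fin b) K)
      = MvPolynomial.X (Sum.inr k)
        * pderiv (Sum.inr j) (h : MvPolynomial (Fin a ⊕ Fin b) K) := rfl

theorem mulBy_pow_apply {R : Type*} [CommRing R] [Algebra K R] (f h : R) (n : ℕ) :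
 ((diffOpRing.mulBy K f).1 ^ n) h = f ^ n * h := by
  change (LinearMap.mulLeft K f ^ n) h = _
  rw [LinearMap.pow_mulLeft, LinearMap.mulLeft_apply]

section

variable {K} (i : Fin a) (j : Fin b) (n : ℕ)

local notation "G" => ((MvPolynomial.X (Sum.inl i) * MvPolynomial.X (Sum.inr j)) ^ (n + 1) :
  MvPolynomial (Fin a ⊕ Fin b) K)

theorem pderiv_inl_xy_pow (k : Fin a) : pderiv (Sum.inl k) G = if k = i then
    (n + 1 : MvPolynomial (Fin a ⊕ Fin b) K) *
      ((MvPolynomial.X (Sum.inl i) * MvPolynomial.X (Sum.inr j)) ^ n *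
        MvPolynomial.X (Sum.inr j)) else 0 := by
  rw [Derivation.leibniz_pow]
  by_cases hk : k = i
  · simp [hk]
  · simp [hk, Ne.symm hk]

theorem pderiv_inr_xy_pow (k : Fin b) : pderiv (Sum.inr k) G = if k = j then
    (n + 1 : MvPolynomial (Fin a ⊕ Fin b) K) *
      ((MvPolynomial.X (Sum.inl i) * MvPolynomial.X (Sum.inr j)) ^ n *
        MvPolynomial.X (Sum.inl i)) else 0 := by
  rw [Derivation.leibniz_pow]
  by_cases hk : k = j
  · simp [hk]
  · simp [hk, Ne.symm hk]

theorem pderiv_inl_pderiv_inr_xy_pow :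
    pderiv (Sum.inl i) (pderiv (Sum.inr j) G) = (n + 1 : MvPolynomial (Fin a ⊕ Fin b) K) ^ 2 *
      (MvPolynomial.X (Sum.inl i) * MvPolynomial.X (Sum.inr j)) ^ n := by
  have e : pderiv (Sum.inr j) G = (n + 1 : MvPolynomial (Fin a ⊕ Fin b) K) *
      (MvPolynomial.X (Sum.inl i) ^ (n + 1) * MvPolynomial.X (Sum.inr j) ^ n) := by
    rw [pderiv_inr_xy_pow, if_pos rfl]
    ring
  rw [e]
  simp
  ring

/-- Both sums are sandwiches of f^(n+1) by operators of R, so (n + b) ∂x f^(n+1) ∂y is one as well,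
although ∂x and ∂y separately do not act on R. -/
theorem pderiv_sandwich_left {h : MvPolynomial (Fin a ⊕ Fin b) K} (hh : h ∈ segreRing K a b) :
    ∑ k, pderiv (Sum.inl i) (pderiv (Sum.inr k) (G * (MvPolynomial.X (Sum.inr k) *
        pderiv (Sum.inr j) h)))
      - ∑ k, MvPolynomial.X (Sum.inl k) * pderiv (Sum.inl i) (G * pderiv (Sum.inl k)
        (pderiv (Sum.inr j) h))
      = (n + b : MvPolynomial (Fin a ⊕ Fin b) K) * pderiv (Sum.inl i) (G * pderiv (Sum.inr j) h)
        + G * pderiv (Sum.inl i) (pderiv (Sum.inr j) h) := by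
  have := sum_sub_sum_derivation_sandwich
    (fun k : Fin a => pderiv (R := K) (Sum.inl k : Fin a ⊕ Fin b))
    (fun k : Fin b => pderiv (R := K) (Sum.inr k : Fin a ⊕ Fin b))
    (fun k => MvPolynomial.X (Sum.inl k)) (fun k => MvPolynomial.X (Sum.inr k))
    (fun _ _ => by simp [pderiv_X_eq_ite, -MvPolynomial.pderiv_X])
    (fun _ _ => by simp [pderiv_X_eq_ite, -MvPolynomial.pderiv_X]) (by simp)
    (fun _ _ _ => MvPolynomial.pderiv_pderiv_comm _ _ _)
    (fun _ _ _ => MvPolynomial.pderiv_pderiv_comm _ _ _)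
    (fun _ _ _ => MvPolynomial.pderiv_pderiv_comm _ _ _) i j G h (n + 1)
    (by simp only [pderiv_inr_xy_pow, mul_ite, mul_zero, Finset.sum_ite_eq', Finset.mem_univ,
          if_true]
        ring) (by simp) (sum_X_mul_pderiv_eq_of_mem_segreRing K hh)
  rwa [add_sub_cancel_right, Fintype.card_fin] at this

theorem pderiv_sandwich_right {h : MvPolynomial (Fin a ⊕ Fin b) K} (hh : h ∈ segreRing K a b) :
    ∑ k, pderiv (Sum.inl k) (pderiv (Sum.inr j) (G * (MvPolynomial.X (Sum.inl k) *
        pderiv (Sum.inl i) h)))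
      - ∑ k, MvPolynomial.X (Sum.inr k) * pderiv (Sum.inr j) (G * pderiv (Sum.inl i)
        (pderiv (Sum.inr k) h))
      = (n + a : MvPolynomial (Fin a ⊕ Fin b) K) * pderiv (Sum.inr j) (G * pderiv (Sum.inl i) h)
        + G * pderiv (Sum.inl i) (pderiv (Sum.inr j) h) := by
  have := sum_sub_sum_derivation_sandwich
    (fun k : Fin b => pderiv (R := K) (Sum.inr k : Fin a ⊕ Fin b))
    (fun k : Fin a => pderiv (R := K) (Sum.inl k : Fin a ⊕ Fin b))
    (fun k => MvPolynomial.X (Sum.inr k)) (fun k => MvPolynomial.X (Sum.inl k))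
    (fun _ _ => by simp [pderiv_X_eq_ite, -MvPolynomial.pderiv_X])
    (fun _ _ => by simp [pderiv_X_eq_ite, -MvPolynomial.pderiv_X]) (by simp)
    (fun _ _ _ => MvPolynomial.pderiv_pderiv_comm _ _ _)
    (fun _ _ _ => MvPolynomial.pderiv_pderiv_comm _ _ _)
    (fun _ _ _ => MvPolynomial.pderiv_pderiv_comm _ _ _) j i G h (n + 1)
    (by simp only [pderiv_inl_xy_pow, mul_ite, mul_zero, Finset.sum_ite_eq', Finset.mem_univ,
          if_true]
        ring) (by simp) (sum_X_mul_pderiv_eq_of_mem_segreRing K hh).symm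
  rw [add_sub_cancel_right, Fintype.card_fin] at this
  simpa only [MvPolynomial.pderiv_pderiv_comm (Sum.inr j) (Sum.inl _),
    MvPolynomial.pderiv_pderiv_comm (Sum.inr _) (Sum.inl i)] using this

theorem pderiv_pderiv_mul {h : MvPolynomial (Fin a ⊕ Fin b) K} :
    pderiv (Sum.inl i) (pderiv (Sum.inr j) (G * h))
      = (n + 1 : MvPolynomial (Fin a ⊕ Fin b) K) ^ 2 *
          (MvPolynomial.X (Sum.inl i) * MvPolynomial.X (Sum.inr j)) ^ n * h
        + pderiv (Sum.inl i) (G * pderiv (Sum.inr j) h)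
        + pderiv (Sum.inr j) (G * pderiv (Sum.inl i) h)
        - G * pderiv (Sum.inl i) (pderiv (Sum.inr j) h) := by
  rw [← pderiv_inl_pderiv_inr_xy_pow]
  generalize G = g
  simp only [MvPolynomial.pderiv_mul, map_add,
    MvPolynomial.pderiv_pderiv_comm (Sum.inr j) (Sum.inl i)]
  ring

end

theorem satisfiesSBSEquation_xy (i : Fin a) (j : Fin b) :
    SatisfiesSBSEquation K (xy K i j)
      ((X + 1) ^ 2 * (X + C (a : K)) * (X + C (b : K))) := by
  have hA1 := IsSandwich.mul_mul (f := xy K i j) (pderivPderiv K i j) 1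
  have hA2 := IsSandwich.mul_mul (f := xy K i j) 1 (pderivPderiv K i j)
  have hB := IsSandwich.sum Finset.univ fun k _ =>
    IsSandwich.mul_mul (f := xy K i j) (xPderiv K k i) (pderivPderiv K k j)
  have hC := IsSandwich.sum Finset.univ fun k _ =>
    IsSandwich.mul_mul (f := xy K i j) (pderivPderiv K i k) (yPderiv K k j)
  have hB' := IsSandwich.sum Finset.univ fun k _ =>
    IsSandwich.mul_mul (f := xy K i j) (yPderiv K k j) (pderivPderiv K i k)
  have hC' := IsSandwich.sum Finset.univ fun k _ =>
    IsSandwich.mul_mul (f := xy K i j) (pderivPderiv K k j) (xPderiv K k i)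
  -- The first term is (n+a)(n+b)(∂x∂y f^(n+1) + f^(n+1) ∂x∂y). The other two remove (n+a)(n+b) ∂x
  -- f^(n+1) ∂y and (n+a)(n+b) ∂y f^(n+1) ∂x; in each, hA2 cancels the extra summand f^(n+1) ∂x∂y of
  -- the Euler identity.
  have H := (((hA1.add hA2).smul ((X + C (a : K)) * (X + C (b : K)))).sub
    (((hC.sub hB).sub hA2).smul (X + C (a : K)))).sub
    (((hC'.sub hB').sub hA2).smul (X + C (b : K)))
  obtain ⟨t, α, β, H⟩ := H
  refine ⟨t, α, β, fun n => (H n).trans ?_⟩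
  refine Subtype.ext (LinearMap.ext fun h => Subtype.ext ?_)
  obtain ⟨h, hmem⟩ := h
  have L₁ := pderiv_sandwich_left i j n hmem
  have L₂ := pderiv_sandwich_right i j n hmem
  have L₃ := pderiv_pderiv_mul i j n (h := h)
  have hxy : (xy K i j : MvPolynomial (Fin a ⊕ Fin b) K)
      = MvPolynomial.X (Sum.inl i) * MvPolynomial.X (Sum.inr j) := rfl
  rw [← hxy] at L₁ L₂ L₃
  simp [mulBy_pow_apply, coe_pderivPderiv_apply, coe_xPderiv_apply, coe_yPderiv_apply,
    -Derivation.leibniz, -Derivation.leibniz_pow]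
  rw [L₁, L₂, L₃]
  simp only [MvPolynomial.smul_eq_C_mul, map_mul, map_add, map_natCast, map_pow, map_one]
  ring

end segreRing

end SegreOperators

/-! ### Conclusion -/

theorem mainTheorem10 (K : Type*) [Field K] [CharZero K] (a b : ℕ) (ha : 1 < a) (hb : 1 < b) :
    let f : segreRing K a b := segreRing.xy K ⟨0, by omega⟩ ⟨0, by omega⟩
    sbsPolynomial K f ≠ 0 ∧
      sbsPolynomial K f ∣ (X + 1) ^ 3 * (X + C (a : K)) * (X + C (b : K)) ∧
      (sbsPolynomial K f).IsRoot (-1) ∧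
      (sbsPolynomial K f).IsRoot (-(a : K)) ∧
      (sbsPolynomial K f).IsRoot (-(b : K)) := by
  intro f
  have hsat : SatisfiesSBSEquation K f ((X + 1) ^ 2 * (X + C (a : K)) * (X + C (b : K))) :=
    segreRing.satisfiesSBSEquation_xy K _ _
  have hdvd : sbsPolynomial K f ∣ (X + 1) ^ 2 * (X + C (a : K)) * (X + C (b : K)) := by
    rw [← Ideal.mem_span_singleton, span_sbsPolynomial]
    exact hsat
  have hmem : SatisfiesSBSEquation K f (sbsPolynomial K f) := by
    have := Ideal.mem_span_singleton_self (sbsPolynomial K f)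
    rwa [span_sbsPolynomial] at this
  -- The explicit equation already has only (s+1)^2; the third factor s + 1 is padding.
  refine ⟨fun h0 => ?_, hdvd.trans ⟨X + 1, by ring⟩,
    segreRing.eval_neg_one_of_satisfiesSBSEquation K ha hb _ _ hmem,
    segreRing.eval_neg_left_of_satisfiesSBSEquation K ha hb _ _ hmem,
    segreRing.eval_neg_right_of_satisfiesSBSEquation K ha hb _ _ hmem⟩
  rw [h0, zero_dvd_iff] at hdvd
  have hmonic : ((X + 1) ^ 2 * (X + C (a : K)) * (X + C (b : K)) : K[X]).Monic := by
    have h1 : (X + 1 : K[X]).Monic := by simpa using monic_X_add_C (1 : K)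
    exact ((h1.pow 2).mul (monic_X_add_C _)).mul (monic_X_add_C _)
  exact hmonic.ne_zero hdvd
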